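/- Let $(R,\mathfrak m)$ be a Cohen--Macaulay (Noetherian) local ring of dimension $d\ge 2$, and let $I=(x_1,\dots,x_d)$ be a parameter ideal of $R$, with $x_1,\dots,x_d$ a fixed system of parameters generating it. Let $\mathcal R(I)=\bigoplus_{n\ge 0} I^nt^n$ be the Rees algebra, which has dimension $d+1$, let $\mathcal I=(I,It)\mathcal R(I)$, and for $s\ge 1$ let $\mathcal I^{[s]}=(x_1^s,\dots,x_d^s,(x_1t)^s,\dots,(x_dt)^s)\mathcal R(I)$. Let $e_0(I)=\lim_{n\to\infty} d!\,\ell_R(R/I^n)/n^d$ be the Hilbert--Samuel multiplicity of $I$ and put $c(d)=\frac d2+\frac d{(d+1)!}$. Then $\ell_R(\mathcal R(I)/\mathcal I^{[s]})$ is finite for all $s\ge1$, and: (1) Let $1\le s<d$ and write $d=k_1s+k_2$ with $k_2\in\{0,1,\dots,s-1\}$. If $k_2=0$, then \[ \ell_R\Big(\frac{\mathcal R(I)}{\mathcal I^{[s]}}\Big)=e_0(I)\Big[(d-k_1+1)s^{d+1}+d\binom{s+d-1}{d+1}-\sum_{i=0}^{d-1}(-1)^i\binom di\binom{(d-i-k_1+1)s+d-1}{d+1}\Big].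 \] If $k_2\ne0$, then \[ \ell_R\Big(\frac{\mathcal R(I)}{\mathcal I^{[s]}}\Big)=e_0(I)\Big[(d-k_1)s^{d+1}+d\binom{s+d-1}{d+1}-\sum_{i=0}^{d-1}(-1)^i\binom di\binom{(d-i-k_1)s+d-1}{d+1}\Big]. \] (2) If $s\ge d$, then \[ \ell_R\Big(\frac{\mathcal R(I)}{\mathcal I^{[s]}}\Big)=e_0(I)\Big[\frac{ds^{d+1}}2-\frac{s^d(d-2)}2+d\binom{s+d-1}{d+1}\Big]. \] In other words, for $s\ge d$ the length is given by a polynomial in $s$ of degree $d+1$, \[ \ell_R\Big(\frac{\mathcal R(I)}{\mathcal I^{[s]}}\Big)=c(d)e_0(I)s^{d+1}+e_0(I)\Big(\frac{d-2}2\Big)\Big(\frac1{(d-1)!}-1\Big)s^d+e_0(I)\frac{d(d-1)(3d-10)}{24\,(d-1)!}s^{d-1}+\cdots, \] and hence the generalized Hilbert--Kunz multiplicity of $\mathcal I$, that is, $\lim_{s\to\infty}\ell_R(\mathcal R(I)/\mathcal I^{[s]})/s^{\dim\mathcal R(I)}$, exists and equals $c(d)e_0(I)$. -/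

import Mathlib

open Filter Topology

/-- The Krull dimension of a ring as a natural number (for rings of finite Krull dimension). -/
noncomputable def krullDimNat (A : Type*) [CommRing A] : ℕ :=
  ((ringKrullDim A).unbotD 0).toNat

/-- The depth of a local ring `R`: the supremum of the lengths of the `R`-regular sequences
contained in the maximal ideal. -/
noncomputable def localDepth (R : Type*) [CommRing R] [IsLocalRing R] : ℕ∞ :=
  ⨆ rs : {rs : List R //
      RingTheory.Sequence.IsRegular R rs ∧ ∀ r ∈ rs, r ∈ IsLocalRing.maximalIdeal R},
    (rs.1.length : ℕ∞)

/-- A Noetherian local ring is Cohen-Macaulay if its depth equals its Krull dimension. -/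
def IsCohenMacaulayLocal (R : Type*) [CommRing R] [IsLocalRing R] : Prop :=
  IsNoetherianRing R ∧ ((localDepth R : ℕ∞) : WithBot ℕ∞) = ringKrullDim R

/-- A parameter ideal of a local ring: an ideal generated by a system of parameters, that is,
by `dim R` elements that generate an ideal primary to the maximal ideal. -/
def IsParameterIdeal {R : Type*} [CommRing R] [IsLocalRing R] (I : Ideal R) : Prop :=
  I.radical = IsLocalRing.maximalIdeal R ∧
    ∃ (n : ℕ) (y : Fin n → R), ringKrullDim R = n ∧ Ideal.span (Set.range y) = I

/-- The Hilbert-Samuel multiplicity `e₀(I) = lim (dim R)! ℓ(R / I ^ n) / n ^ (dim R)`. -/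
noncomputable def hilbertSamuelMultiplicity {R : Type*} [CommRing R] (I : Ideal R) : ℝ :=
  limUnder atTop (fun n : ℕ =>
    ((krullDimNat R).factorial : ℝ) * ((Module.length R (R ⧸ I ^ n)).toNat : ℝ) /
      (n : ℝ) ^ krullDimNat R)

/-- The ideal `J^{[s]}` generated by the `s`-th powers of a fixed family `a` of generators
of `J`. -/
def bracketPower {A ι : Type*} [CommRing A] (a : ι → A) (s : ℕ) : Ideal A :=
  Ideal.span (Set.range fun i => a i ^ s)

/-- The generalized Hilbert-Kunz function `s ↦ ℓ_R(A / J^{[s]})` of the ideal `J` of the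
`R`-algebra `A` with respect to a fixed family `a` of generators of `J`. -/
noncomputable def generalizedHK (R : Type*) {A ι : Type*} [CommRing R] [CommRing A] [Algebra R A]
    (a : ι → A) (s : ℕ) : ℕ∞ :=
  Module.length R (A ⧸ bracketPower a s)

/-- `e` is the generalized Hilbert-Kunz multiplicity of the ideal generated by `a`: the limit of
`ℓ_R(A / J^{[s]}) / s ^ (dim A)` exists and equals `e`. -/
def HasGeneralizedHKMultiplicity (R : Type*) {A ι : Type*} [CommRing R] [CommRing A] [Algebra R A]
    (a : ι → A) (e : ℝ) : Prop :=
  Tendsto (fun s : ℕ => ((generalizedHK R a s).toNat : ℝ) / (s : ℝ) ^ krullDimNat A) atTop (𝓝 e)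

/-- The homogeneous element `r t` of degree one of the Rees algebra, for `r ∈ I`. -/
noncomputable def reesDegreeOne {R : Type*} [CommRing R] (I : Ideal R) (r : R) (hr : r ∈ I) :
    reesAlgebra I :=
  ⟨Polynomial.monomial 1 r, reesAlgebra.monomial_mem.mpr (by rwa [pow_one])⟩

/-- The ideal `(I, It)` of the Rees algebra of `I`. -/
noncomputable def reesIdeal {R : Type*} [CommRing R] (I : Ideal R) : Ideal (reesAlgebra I) :=
  Ideal.map (algebraMap R (reesAlgebra I)) I ⊔
    Ideal.span (Set.range fun r : I => reesDegreeOne I r.1 r.2)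

/-- The generators `x₁, …, x_d, x₁ t, …, x_d t` of `(I, It)` attached to generators
`x₁, …, x_d` of `I`. -/
noncomputable def reesGenerators {R ι : Type*} [CommRing R] (x : ι → R) :
    ι ⊕ ι → reesAlgebra (Ideal.span (Set.range x)) :=
  Sum.elim (fun i => algebraMap R (reesAlgebra (Ideal.span (Set.range x))) (x i))
    (fun i => reesDegreeOne (Ideal.span (Set.range x)) (x i)
      (Ideal.subset_span (Set.mem_range_self i)))

theorem span_reesGenerators {R ι : Type*} [CommRing R] (x : ι → R) :
    Ideal.span (Set.range (reesGenerators x)) = reesIdeal (Ideal.span (Set.range x)) := by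
  apply le_antisymm
  · rw [Ideal.span_le]
    rintro _ ⟨i | i, rfl⟩
    · exact Ideal.mem_sup_left
        (Ideal.mem_map_of_mem _ (Ideal.subset_span (Set.mem_range_self i)))
    · exact Ideal.mem_sup_right (Ideal.subset_span
        ⟨⟨x i, Ideal.subset_span (Set.mem_range_self i)⟩, rfl⟩)
  · refine sup_le ?_ ?_
    · rw [Ideal.map_span, Ideal.span_le]
      rintro _ ⟨_, ⟨i, rfl⟩, rfl⟩
      exact Ideal.subset_span ⟨Sum.inl i, rfl⟩
    · rw [Ideal.span_le]
      rintro _ ⟨⟨r, hr⟩, rfl⟩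
      induction hr using Submodule.span_induction with
      | mem r h =>
        obtain ⟨i, rfl⟩ := h
        exact Ideal.subset_span ⟨Sum.inr i, rfl⟩
      | zero =>
        have h0 : reesDegreeOne (Ideal.span (Set.range x)) 0 (Submodule.zero_mem _) = 0 :=
          Subtype.ext (by simp [reesDegreeOne])
        simp only [h0]
        exact Submodule.zero_mem _
      | add a b ha hb iha ihb =>
        have h1 : reesDegreeOne (Ideal.span (Set.range x)) (a + b) (Submodule.add_mem _ ha hb)
            = reesDegreeOne _ a ha + reesDegreeOne _ b hb :=
          Subtype.ext (by simp [reesDegreeOne])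
        simp only [h1]
        exact Submodule.add_mem _ iha ihb
      | smul c a ha iha =>
        have h1 : reesDegreeOne (Ideal.span (Set.range x)) (c • a) (Submodule.smul_mem _ c ha)
            = algebraMap R _ c * reesDegreeOne _ a ha :=
          Subtype.ext (by
            change Polynomial.monomial 1 (c • a) = Polynomial.C c * Polynomial.monomial 1 a
            simp [Polynomial.C_mul_monomial])
        simp only [h1]
        exact Ideal.mul_mem_left _ _ iha

/-- The constant `c(d) = d / 2 + d / (d + 1)!`. -/
noncomputable def hkConstant (d : ℕ) : ℝ := (d : ℝ) / 2 + (d : ℝ) / ((d + 1).factorial : ℝ)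

/-! ### Cohen–Macaulay modules: systems of parameters are regular sequences. -/

section RegularSystemOfParameters

open RingTheory.Sequence IsLocalRing Ideal CategoryTheory Abelian Limits Pointwise

universe u

/-! In a Cohen–Macaulay ring each parameter x_j is regular modulo positive powers of the others
(`IsCohenMacaulayLocal.mem_span_pow_of_mul_mem`), so monomials in x behave as over a polynomial
ring. Take a span of monomials closed under multiplication by the x_k and adjoin the finitely many
missing monomials, highest degree first: every step contributes one copy of R/I
(`Module.length_quotient_span_image_monomials`). For I^n this gives ℓ(R/I^n) = C(n+d-1, d) ℓ(R/I),
hence e₀(I) = ℓ(R/I). For the bracket ideal of the Rees algebra it gives N(s) e₀(I), where N(s)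
counts the monomials x^a t^n, n ≤ |a|, outside that ideal.

Such a monomial lies in the ideal iff some a_k ≥ s and either n + s ≤ |a| (divide by x_k^s) or n ≥ s
(divide by (x_k t)^s). The others are of two kinds. If all a_i < s, any n ≤ |a| is allowed, which
gives s^d + d(s-1)s^d/2. If a_k ≥ s, then |a| - s < n < s, so |a| < 2s and k is unique; subtracting
s from a_k leaves pairs |b| < n < s, which gives C(s+d-1, d+1) for each k.

So the closed formula of the case s ≥ d holds for every s ≥ 1. The formulas for s < d only rewrite
it: with its vanishing i = d term added, the alternating sum is a d-th finite difference of a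
polynomial of degree d+1, hence explicitly linear in the base point
(`two_mul_fwdDiff_iter_ringChoose`). The polynomial and its leading coefficients come from rising
factorials, and the limit also needs that the Rees algebra has dimension d+1
(`ringKrullDim_reesAlgebra`). -/

theorem RingTheory.Sequence.IsRegular.mem_maximalIdeal {R : Type*} [CommRing R]
    [IsLocalRing R] {M : Type*} [AddCommGroup M]
    [Module R M] {rs : List R} (reg : IsRegular M rs) : ∀ r ∈ rs, r ∈ maximalIdeal R := by
  intro r hr
  refine IsLocalRing.le_maximalIdeal ?_ (Ideal.subset_span (s := {r | r ∈ rs}) hr)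
  exact reg.2 ∘ Eq.trans (Submodule.top_smul _).symm ∘ Eq.symm ∘ congrArg (· • ⊤)

variable {R : Type u} [CommRing R] [IsLocalRing R] [IsNoetherianRing R]

/-- Write p = ann(u). By Krull's intersection theorem u = a^k v with v not in aM, and p still kills
v because a is regular. The class of v in M/aM is then nonzero and killed by p and by a, while a is
not in p. -/
theorem IsSMulRegular.exists_isAssociatedPrime_quotSMulTop {M : Type u} [AddCommGroup M]
    [Module R M] [Module.Finite R M] {a : R} (ha : IsSMulRegular M a) (ham : a ∈ maximalIdeal R)
    {p : Ideal R} (hp : IsAssociatedPrime p M) :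
    ∃ q : Ideal R, IsAssociatedPrime q (QuotSMulTop a M) ∧ p < q := by
  obtain ⟨hpp, u, hu⟩ := isAssociatedPrime_iff.mp hp
  have hu0 : u ≠ 0 := by
    rintro rfl
    apply hpp.ne_top
    simp [hu]
  have hex : ∃ n : ℕ, ¬ ∃ v : M, u = a ^ n • v := by
    by_contra! h
    apply hu0
    have hb := Ideal.iInf_pow_smul_eq_bot_of_isLocalRing (M := M) (Ideal.span {a})
      (by rw [Ne, Ideal.span_singleton_eq_top]; exact ham)
    rw [← Submodule.mem_bot R, ← hb, Submodule.mem_iInf]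
    intro n
    obtain ⟨v, hv⟩ := h n
    rw [hv]
    exact Submodule.smul_mem_smul (Ideal.pow_mem_pow (Ideal.mem_span_singleton_self a) n)
      Submodule.mem_top
  classical
  obtain ⟨hn, hmin⟩ := And.intro (Nat.find_spec hex) (fun m => Nat.find_min hex (m := m))
  set n := Nat.find hex with hndef
  have hn0 : n ≠ 0 := by
    intro h
    apply hn
    rw [h]
    exact ⟨u, by simp⟩
  obtain ⟨k, hk⟩ := Nat.exists_eq_succ_of_ne_zero hn0
  obtain ⟨v, hv⟩ := not_not.mp (hmin k (by omega))
  set w : QuotSMulTop a M := Submodule.Quotient.mk v with hw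
  have hw0 : w ≠ 0 := by
    intro h
    rw [hw, Submodule.Quotient.mk_eq_zero, Submodule.mem_smul_pointwise_iff_exists] at h
    obtain ⟨v', -, rfl⟩ := h
    apply hn
    refine ⟨v', ?_⟩
    rw [hv, hk, pow_succ, mul_smul]
  obtain ⟨q, hq, hle⟩ := exists_le_isAssociatedPrime_of_isNoetherianRing R w hw0
  have haq : a ∈ q := by
    apply hle
    rw [Submodule.mem_colon_singleton, Submodule.mem_bot, hw, ← Submodule.Quotient.mk_smul,
      Submodule.Quotient.mk_eq_zero]
    exact Submodule.smul_mem_pointwise_smul _ _ _ Submodule.mem_top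
  have hap : a ∉ p := by
    rw [hu, Submodule.mem_colon_singleton, Submodule.mem_bot]
    intro h
    exact hu0 (ha (by simpa using h))
  refine ⟨q, hq, lt_of_le_of_ne ?_ (fun h => hap (h ▸ haq))⟩
  intro r hr
  apply hle
  rw [hu, Submodule.mem_colon_singleton, Submodule.mem_bot, hv, smul_comm] at hr
  have hr' : r • v = 0 := (ha.pow k) (by simpa using hr)
  rw [Submodule.mem_colon_singleton, Submodule.mem_bot, hw, ← Submodule.Quotient.mk_smul, hr',
    Submodule.Quotient.mk_zero]

/-- The bound of depth by dim R/p: each element of the sequence lifts p to a strictly larger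
associated prime of the next quotient. -/
theorem RingTheory.Sequence.IsRegular.length_le_coheight {M : Type u} [AddCommGroup M]
    [Module R M] [Module.Finite R M] {rs : List R} (reg : IsRegular M rs)
    {p : Ideal R} (hp : IsAssociatedPrime p M) :
    (rs.length : ℕ∞) ≤ Order.coheight (⟨p, hp.isPrime⟩ : PrimeSpectrum R) := by
  induction rs generalizing M p with
  | nil => simp
  | cons a rs ih =>
    have ham := reg.mem_maximalIdeal a (by simp)
    rw [isRegular_cons_iff] at reg
    obtain ⟨q, hq, hlt⟩ := reg.1.exists_isAssociatedPrime_quotSMulTop ham hp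
    have h1 := ih reg.2 hq
    have h2 : (⟨p, hp.isPrime⟩ : PrimeSpectrum R) < ⟨q, hq.isPrime⟩ := hlt
    have h3 := Order.coheight_add_one_le h2
    simp only [List.length_cons, Nat.cast_add, Nat.cast_one]
    exact le_trans (by gcongr) h3

/-- Krull's height theorem in R/p, whose maximal ideal is minimal over the image of s. -/
theorem PrimeSpectrum.coheight_le_card_of_le_radical {p : Ideal R} (hp : p.IsPrime) {s : Finset R}
    (hs : maximalIdeal R ≤ (p ⊔ Ideal.span (s : Set R)).radical)
    (hsm : (s : Set R) ⊆ maximalIdeal R) :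
    Order.coheight (⟨p, hp⟩ : PrimeSpectrum R) ≤ s.card := by
  have e : (Order.coheight (⟨p, hp⟩ : PrimeSpectrum R) : WithBot ℕ∞) = ringKrullDim (R ⧸ p) := by
    rw [ringKrullDim_quotient, Order.coheight_eq_krullDim_Ici]
    rfl
  have : Nontrivial (R ⧸ p) := Ideal.Quotient.nontrivial_iff.mpr hp.ne_top
  have : IsLocalRing (R ⧸ p) := .of_surjective' _ Ideal.Quotient.mk_surjective
  have : IsLocalHom (Ideal.Quotient.mk p) :=
    .of_surjective _ Ideal.Quotient.mk_surjective
  classical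
  have hmin : maximalIdeal (R ⧸ p) ∈
      (Ideal.span ((s.image (Ideal.Quotient.mk p) : Finset (R ⧸ p)) : Set (R ⧸ p))).minimalPrimes := by
    refine ⟨⟨inferInstance, ?_⟩, ?_⟩
    · rw [Ideal.span_le]
      intro y hy
      simp only [Finset.coe_image, Set.mem_image] at hy
      obtain ⟨x, hx, rfl⟩ := hy
      have := hsm hx
      simp only [SetLike.mem_coe, mem_maximalIdeal, mem_nonunits_iff] at this ⊢
      intro h
      exact this (isUnit_of_map_unit _ _ h)
    · rintro Q ⟨hQ, hle⟩ -
      intro y hy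
      obtain ⟨x, rfl⟩ := Ideal.Quotient.mk_surjective y
      have hx : x ∈ maximalIdeal R := by
        simp only [mem_maximalIdeal, mem_nonunits_iff] at hy ⊢
        exact fun h => hy (h.map _)
      have hQ' : (p ⊔ Ideal.span (s : Set R)).radical ≤ Q.comap (Ideal.Quotient.mk p) := by
        rw [(hQ.comap _).radical_le_iff, sup_le_iff]
        constructor
        · intro z hz
          rw [Ideal.mem_comap, Ideal.Quotient.eq_zero_iff_mem.mpr hz]
          exact Q.zero_mem
        · rw [← Ideal.map_le_iff_le_comap, Ideal.map_span, ← Finset.coe_image]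
          exact hle
      exact hQ' (hs hx)
  have h1 := Ideal.height_le_card_of_mem_minimalPrimes_span_finset hmin
  have h2 := IsLocalRing.maximalIdeal_height_eq_ringKrullDim (R := R ⧸ p)
  have h3 : (s.image (Ideal.Quotient.mk p)).card ≤ s.card := Finset.card_image_le
  have : ((maximalIdeal (R ⧸ p)).height : WithBot ℕ∞) ≤ ((s.card : ℕ∞) : WithBot ℕ∞) := by
    exact_mod_cast h1.trans (by exact_mod_cast h3)
  rw [h2, ← e] at this
  exact_mod_cast this

/-- Depth drops by only one modulo any regular element, even one unrelated to the given sequence.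
Depth is read off from the vanishing of Ext in low degrees, which passes to M/aM through the long
exact sequence of multiplication by a. -/
theorem exists_isRegular_quotSMulTop_of_isSMulRegular {M : Type u} [AddCommGroup M]
    [Module R M] [Module.Finite R M] {n : ℕ} {rs : List R} (reg : IsRegular M rs)
    (hlen : rs.length = n + 1) {a : R} (ha : IsSMulRegular M a) (ham : a ∈ maximalIdeal R) :
    ∃ rs' : List R, rs'.length = n ∧ IsRegular (QuotSMulTop a M) rs' := by
  have := reg.nontrivial
  have : Nontrivial (QuotSMulTop a M) := nontrivial_quotSMulTop_of_mem_maximalIdeal M ham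
  have lt_top (N : Type u) [AddCommGroup N] [Module R N] [Module.Finite R N] [Nontrivial N] :
      maximalIdeal R • (⊤ : Submodule R N) < ⊤ :=
    (Submodule.top_ne_ideal_smul_of_le_jacobson_annihilator (maximalIdeal_le_jacobson _)).symm.lt_top
  have t1 := ModuleCat.exists_isRegular_tfae (maximalIdeal R) (n + 1) (ModuleCat.of R M)
    (lt_top M)
  have t2 := ModuleCat.exists_isRegular_tfae (maximalIdeal R) n
    (ModuleCat.of R (QuotSMulTop a M)) (lt_top _)
  have e1 := t1.out 1 3
  have e2 := t2.out 1 3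
  have h1 := e1.mpr ⟨rs, hlen, reg.mem_maximalIdeal, reg⟩
  have h2 := e2.mp (by
    intro i hi
    have zero1 := AddCommGrpCat.isZero_of_iff_subsingleton.mpr (h1 i (by omega))
    have zero2 := AddCommGrpCat.isZero_of_iff_subsingleton.mpr (h1 (i + 1) (by omega))
    exact AddCommGrpCat.subsingleton_of_isZero <| ShortComplex.Exact.isZero_of_both_zeros
      ((Ext.covariant_sequence_exact₃' _
        (IsSMulRegular.smulShortComplex_shortExact (M := ModuleCat.of R M) ha)) i (i + 1) rfl)
      (zero1.eq_zero_of_src _) (zero2.eq_zero_of_tgt _))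
  obtain ⟨rs', hl, -, hr⟩ := h2
  exact ⟨rs', hl, hr⟩

/-- If the first parameter lay in an associated prime p, the remaining ones would generate the
maximal ideal up to radical modulo p, so dim R/p would be less than the length of the given regular
sequence. Both hypotheses survive passage to the quotient, so induction applies. -/
theorem isWeaklyRegular_of_maximalIdeal_le_radical {M : Type u} [AddCommGroup M]
    [Module R M] [Module.Finite R M] {rs : List R} (reg : IsRegular M rs) (xs : List R)
    (hlen : xs.length = rs.length) (hxm : ∀ a ∈ xs, a ∈ maximalIdeal R)
    (hx : maximalIdeal R ≤ (Module.annihilator R M ⊔ Ideal.ofList xs).radical) :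
    IsWeaklyRegular M xs := by
  induction xs generalizing M rs with
  | nil => exact .nil R M
  | cons a xs ih =>
    have ham := hxm a (by simp)
    have ha : IsSMulRegular M a := by
      by_contra hna
      have hmem : a ∈ ⋃ p ∈ associatedPrimes R M, (p : Set R) := by
        rw [biUnion_associatedPrimes_eq_compl_regular]
        exact hna
      simp only [Set.mem_iUnion, exists_prop] at hmem
      obtain ⟨p, hp, hap⟩ := hmem
      have h1 := reg.length_le_coheight hp
      classical
      have h2 : Order.coheight (⟨p, hp.isPrime⟩ : PrimeSpectrum R) ≤ xs.toFinset.card := by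
        apply PrimeSpectrum.coheight_le_card_of_le_radical
        · refine hx.trans (Ideal.radical_mono ?_)
          rw [Ideal.ofList_cons]
          refine sup_le ?_ (sup_le ?_ ?_)
          · refine le_trans ?_ le_sup_left
            rw [← Submodule.annihilator_top]
            exact hp.annihilator_le
          · rw [Ideal.span_singleton_le_iff_mem]
            exact Ideal.mem_sup_left hap
          · refine le_trans (le_of_eq ?_) le_sup_right
            simp [Ideal.ofList]
        · intro y hy
          exact hxm y (by simp at hy; simp [hy])
      have h3 : (rs.length : ℕ∞) ≤ (xs.length : ℕ∞) :=
        h1.trans (h2.trans (by exact_mod_cast List.toFinset_card_le xs))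
      have h4 : rs.length ≤ xs.length := by exact_mod_cast h3
      simp at hlen
      omega
    obtain ⟨rs', hl, hr⟩ := exists_isRegular_quotSMulTop_of_isSMulRegular (n := xs.length) reg
      (by simp at hlen; omega) ha ham
    refine IsWeaklyRegular.cons ha (ih hr hl.symm (fun y hy => hxm y (by simp [hy])) ?_)
    refine hx.trans (Ideal.radical_mono ?_)
    rw [Ideal.ofList_cons, ← sup_assoc]
    refine sup_le_sup_right (sup_le ?_ ?_) _
    · exact LinearMap.annihilator_le_of_surjective _ (Submodule.mkQ_surjective _)
    · rw [Ideal.span_singleton_le_iff_mem]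
      exact QuotSMulTop.mem_annihilator M a

end RegularSystemOfParameters

theorem IsCohenMacaulayLocal.exists_isRegular {R : Type*} [CommRing R] [IsLocalRing R]
    (hCM : IsCohenMacaulayLocal R) {d : ℕ} (hdim : ringKrullDim R = d) (hd : 1 ≤ d) :
    ∃ rs : List R, RingTheory.Sequence.IsRegular R rs ∧ rs.length = d := by
  obtain ⟨-, hdepth⟩ := hCM
  rw [hdim] at hdepth
  have hdepth' : localDepth R = d := by exact_mod_cast hdepth
  by_contra! h
  -- A finite supremum of natural numbers is attained; otherwise all lengths would be at most d - 1,
  -- which is less than d as d ≥ 1.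
  have hlt : localDepth R ≤ ((d - 1 : ℕ) : ℕ∞) := by
    refine iSup_le fun rs => ?_
    have h1 : (rs.1.length : ℕ∞) ≤ localDepth R :=
      le_iSup (fun rs : {rs : List R // RingTheory.Sequence.IsRegular R rs ∧
        ∀ r ∈ rs, r ∈ IsLocalRing.maximalIdeal R} => (rs.1.length : ℕ∞)) rs
    rw [hdepth'] at h1
    have h2 : rs.1.length ≤ d := by exact_mod_cast h1
    have h3 := h rs.1 rs.2.1
    have h4 : rs.1.length ≤ d - 1 := by omega
    exact_mod_cast h4
  rw [hdepth'] at hlt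
  have : d ≤ d - 1 := by exact_mod_cast hlt
  omega

theorem IsCohenMacaulayLocal.isWeaklyRegular {R : Type*} [CommRing R] [IsLocalRing R]
    (hCM : IsCohenMacaulayLocal R) {d : ℕ} (hdim : ringKrullDim R = d) (hd : 1 ≤ d)
    (xs : List R) (hlen : xs.length = d)
    (hI : (Ideal.ofList xs).radical = IsLocalRing.maximalIdeal R) :
    RingTheory.Sequence.IsWeaklyRegular R xs := by
  obtain ⟨rs, hreg, hrs⟩ := hCM.exists_isRegular hdim hd
  have := hCM.1
  refine isWeaklyRegular_of_maximalIdeal_le_radical hreg _ (by simp [hlen, hrs]) ?_ ?_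
  · intro a ha
    rw [← hI]
    exact Ideal.le_radical (Ideal.subset_span (s := {r | r ∈ xs}) ha)
  · rw [← hI]
    exact Ideal.radical_mono le_sup_right

/-- In a Cohen-Macaulay local ring every element of a system of parameters is regular modulo
the ideal generated by positive powers of the others. -/
theorem IsCohenMacaulayLocal.mem_span_pow_of_mul_mem {R : Type*} [CommRing R] [IsLocalRing R]
    (hCM : IsCohenMacaulayLocal R) {d : ℕ} (hdim : ringKrullDim R = d) (x : Fin d → R)
    (hI : (Ideal.span (Set.range x)).radical = IsLocalRing.maximalIdeal R) (j : Fin d)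
    (e : Fin d → ℕ) (he : ∀ i, 1 ≤ e i) (r : R)
    (hr : x j * r ∈ Ideal.span ((fun i => x i ^ e i) '' {j}ᶜ)) :
    r ∈ Ideal.span ((fun i => x i ^ e i) '' {j}ᶜ) := by
  classical
  set l : List R := (Finset.univ.erase j).toList.map (fun i => x i ^ e i) with hl
  have hspan : Ideal.ofList l = Ideal.span ((fun i => x i ^ e i) '' {j}ᶜ) := by
    unfold Ideal.ofList
    congr 1
    ext r
    simp [hl]
  have hd : 1 ≤ d := j.pos
  -- Placing x_j last makes its regularity modulo all the other powers the final clause of weak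
  -- regularity.
  have hw : RingTheory.Sequence.IsWeaklyRegular R (l ++ [x j]) := by
    refine hCM.isWeaklyRegular hdim hd _ (by simp [hl]; omega) ?_
    rw [Ideal.ofList_append, Ideal.ofList_singleton, hspan, ← hI]
    apply le_antisymm
    · apply Ideal.radical_mono
      refine sup_le ?_ ?_
      · rw [Ideal.span_le]
        rintro _ ⟨i, -, rfl⟩
        exact Ideal.pow_mem_of_mem _ (Ideal.subset_span (Set.mem_range_self i)) _ (he i)
      · rw [Ideal.span_singleton_le_iff_mem]
        exact Ideal.subset_span ⟨j, rfl⟩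
    · rw [Ideal.radical_le_radical_iff, Ideal.span_le]
      rintro _ ⟨i, rfl⟩
      by_cases hij : i = j
      · subst hij
        exact Ideal.le_radical (Ideal.mem_sup_right (Ideal.mem_span_singleton_self _))
      · exact Ideal.mem_radical_iff.mpr
          ⟨e i, Ideal.mem_sup_left (Ideal.subset_span (Set.mem_image_of_mem _ hij))⟩
  rw [RingTheory.Sequence.isWeaklyRegular_append_iff,
    RingTheory.Sequence.isWeaklyRegular_singleton_iff] at hw
  have h2 := mem_of_isSMulRegular_quotient_of_smul_mem hw.2 (x := r)
  rw [hspan] at h2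
  simpa using h2 (by simpa using hr)

/-! ### Colon ideals of monomials and filtrations with quotients R/(x). -/

section MonomialFiltration

variable {R : Type*} [CommRing R]

/-- The powers are removed one index at a time. If x_j^(b_j) y = x_j^(b_j+1) c + v with v in the
ideal J of powers of the other variables, then cancelling x_j^(b_j) modulo J puts y - x_j c in J,
which lowers the exponent of x_j to 1. -/
theorem mem_span_range_of_mul_prod_mem {ι : Type*} [Fintype ι] (x : ι → R)
    (hx : ∀ (j : ι) (e : ι → ℕ), (∀ i, 1 ≤ e i) → ∀ r : R,
      x j * r ∈ Ideal.span ((fun i => x i ^ e i) '' {j}ᶜ) →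
        r ∈ Ideal.span ((fun i => x i ^ e i) '' {j}ᶜ))
    (b : ι → ℕ) (r : R)
    (hr : r * ∏ i, x i ^ b i ∈ Ideal.span (Set.range fun i => x i ^ (b i + 1))) :
    r ∈ Ideal.span (Set.range x) := by
  classical
  suffices H : ∀ (S : Finset ι) (r : R), r * ∏ i ∈ S, x i ^ b i ∈
      Ideal.span (Set.range fun i => x i ^ (if i ∈ S then b i + 1 else 1)) →
        r ∈ Ideal.span (Set.range x) by
    apply H Finset.univ r
    simpa using hr
  intro S
  induction S using Finset.induction_on with
  | empty => simp
  | insert j S hj ih =>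
    intro r hr
    apply ih
    set e : ι → ℕ := fun i => if i ∈ S then b i + 1 else 1 with he
    have he1 : ∀ i, 1 ≤ e i := by
      intro i
      simp only [he]
      split_ifs <;> omega
    have hpow : ∀ (n : ℕ) (r : R), x j ^ n * r ∈ Ideal.span ((fun i => x i ^ e i) '' {j}ᶜ) →
        r ∈ Ideal.span ((fun i => x i ^ e i) '' {j}ᶜ) := by
      intro n
      induction n with
      | zero => intro r hr; simpa using hr
      | succ n ihn =>
        intro r hr
        refine hx j e he1 r (ihn _ ?_)
        rwa [← mul_assoc, ← pow_succ]
    have hle : Ideal.span (Set.range fun i => x i ^ (if i ∈ insert j S then b i + 1 else 1)) ≤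
        Ideal.span {x j ^ (b j + 1)} ⊔ Ideal.span ((fun i => x i ^ e i) '' {j}ᶜ) := by
      rw [Ideal.span_le]
      rintro _ ⟨i, rfl⟩
      by_cases hij : i = j
      · subst hij
        apply Ideal.mem_sup_left
        simp
      · apply Ideal.mem_sup_right
        apply Ideal.subset_span
        exact ⟨i, hij, by simp [he, hij]⟩
    obtain ⟨u, hu, v, hv, huv⟩ := Submodule.mem_sup.mp (hle hr)
    obtain ⟨c, rfl⟩ := Ideal.mem_span_singleton.mp hu
    have h1 : r * ∏ i ∈ S, x i ^ b i - x j * c ∈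
        Ideal.span ((fun i => x i ^ e i) '' {j}ᶜ) := by
      apply hpow (b j)
      rw [Finset.prod_insert hj] at huv
      convert hv using 1
      linear_combination (exp := 1) -huv
    have h2 : Ideal.span ((fun i => x i ^ e i) '' {j}ᶜ) ≤
        Ideal.span (Set.range fun i => x i ^ e i) :=
      Ideal.span_mono (Set.image_subset_range _ _)
    have h3 : x j * c ∈ Ideal.span (Set.range fun i => x i ^ e i) := by
      apply Ideal.mul_mem_right
      apply Ideal.subset_span
      exact ⟨j, by simp [he, hj]⟩
    have h4 := Ideal.add_mem _ (h2 h1) h3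
    rwa [sub_add_cancel] at h4

/-- Additivity of length on 0 → R/I → N/P → N/(P + Rv) → 0, where 1 maps to the class of v. -/
theorem Module.length_quotient_eq_add_of_colon {N : Type*} [AddCommGroup N] [Module R N]
    (P : Submodule R N) (v : N) (I : Ideal R) (hI : ∀ r : R, r • v ∈ P ↔ r ∈ I) :
    Module.length R (N ⧸ P) =
      Module.length R (R ⧸ I) + Module.length R (N ⧸ (P ⊔ Submodule.span R {v})) := by
  have hker : LinearMap.ker (LinearMap.toSpanSingleton R (N ⧸ P) (P.mkQ v)) = I := by
    ext r
    rw [LinearMap.mem_ker, LinearMap.toSpanSingleton_apply, ← map_smul, Submodule.mkQ_apply,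
      Submodule.Quotient.mk_eq_zero, hI]
  set f : (R ⧸ I) →ₗ[R] N ⧸ P :=
    Submodule.liftQ I (LinearMap.toSpanSingleton R (N ⧸ P) (P.mkQ v)) hker.ge with hf
  refine Module.length_eq_add_of_exact f (Submodule.factor (le_sup_left : P ≤ P ⊔ _)) ?_
    (Submodule.factor_surjective _) ?_
  · rw [← LinearMap.ker_eq_bot]
    exact Submodule.ker_liftQ_eq_bot _ _ _ hker.le
  · rw [LinearMap.exact_iff, hf, Submodule.range_liftQ]
    ext y
    obtain ⟨n, rfl⟩ := Submodule.mkQ_surjective P y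
    rw [LinearMap.mem_ker, LinearMap.mem_range, Submodule.factor_mk, Submodule.mkQ_apply, Submodule.mkQ_apply,
      Submodule.Quotient.mk_eq_zero, Submodule.mem_sup]
    constructor
    · rintro ⟨p, hp, z, hz, rfl⟩
      obtain ⟨c, rfl⟩ := Submodule.mem_span_singleton.mp hz
      refine ⟨c, ?_⟩
      rw [LinearMap.toSpanSingleton_apply, Submodule.mkQ_apply, ← Submodule.Quotient.mk_smul,
        Submodule.Quotient.mk_add, (Submodule.Quotient.mk_eq_zero P).mpr hp, zero_add]
    · rintro ⟨c, hc⟩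
      rw [LinearMap.toSpanSingleton_apply, Submodule.mkQ_apply, ← Submodule.Quotient.mk_smul,
        Submodule.Quotient.eq] at hc
      refine ⟨n - c • v, ?_, c • v, Submodule.mem_span_singleton.mpr ⟨c, rfl⟩, by abel⟩
      rw [← neg_sub]
      exact P.neg_mem hc

/-- The length of the quotient by the submodule spanned by a set of monomials `E` is the number of
monomials outside of `E`, times the length of `R ⧸ (x)`. -/
theorem Module.length_quotient_span_image_monomials {N ι κ : Type*} [AddCommGroup N] [Module R N]
    (m : ι → N) (x : κ → R) (shift : κ → ι → ι) (deg : ι → ℕ)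
    (hm : ∀ k c, m (shift k c) = x k • m c) (hdeg : ∀ k c, deg c < deg (shift k c))
    (hcolon : ∀ E : Set ι, (∀ k, ∀ c ∈ E, shift k c ∈ E) → ∀ c ∉ E, ∀ r : R,
      r • m c ∈ Submodule.span R (m '' E) → r ∈ Ideal.span (Set.range x))
    (hspan : Submodule.span R (Set.range m) = ⊤)
    (F : Finset ι) (hF : ∀ k c, c ∉ F → shift k c ∉ F) :
    Module.length R (N ⧸ Submodule.span R (m '' (F : Set ι)ᶜ)) =
      F.card * Module.length R (R ⧸ Ideal.span (Set.range x)) := by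
  classical
  induction hn : F.card generalizing F with
  | zero =>
    rw [Finset.card_eq_zero] at hn
    subst hn
    have : Subsingleton (N ⧸ Submodule.span R (m '' ((∅ : Finset ι) : Set ι)ᶜ)) := by
      rw [Submodule.Quotient.subsingleton_iff]
      simpa using hspan
    simp [Module.length_eq_zero]
  | succ n ih =>
    -- For c of maximal degree in F all shifts of c leave F, so (x) multiplies its monomial into the
    -- span; with `hcolon` the colon ideal is exactly (x).
    obtain ⟨c, hc, hmax⟩ := F.exists_max_image deg (Finset.card_pos.mp (by omega))
    have hsh : ∀ k, shift k c ∉ F := fun k hk => absurd (hmax _ hk) (not_le.mpr (hdeg k c))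
    have hFc : ((F.erase c : Finset ι) : Set ι)ᶜ = insert c (F : Set ι)ᶜ := by
      ext i
      by_cases h : i = c <;> simp [h]
    have key := Module.length_quotient_eq_add_of_colon
      (Submodule.span R (m '' (F : Set ι)ᶜ)) (m c) (Ideal.span (Set.range x)) (by
        intro r
        constructor
        · exact hcolon _ (fun k c hc => hF k c hc) c (fun h => h hc) r
        · intro hr
          have : Ideal.span (Set.range x) ≤
              (Submodule.span R (m '' (F : Set ι)ᶜ)).comap (LinearMap.toSpanSingleton R N (m c)) := by
            rw [Ideal.span, Submodule.span_le]
            rintro _ ⟨k, rfl⟩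
            simp only [Submodule.comap_coe, Set.mem_preimage, LinearMap.toSpanSingleton_apply,
              SetLike.mem_coe, ← hm]
            exact Submodule.subset_span ⟨_, hsh k, rfl⟩
          exact this hr)
    have hsup : Submodule.span R (m '' (F : Set ι)ᶜ) ⊔ Submodule.span R {m c} =
        Submodule.span R (m '' ((F.erase c : Finset ι) : Set ι)ᶜ) := by
      rw [hFc, Set.image_insert_eq, Submodule.span_insert, sup_comm]
    rw [key, hsup, ih (F.erase c) _ (by rw [Finset.card_erase_of_mem hc]; omega)]
    · push_cast
      ring
    · intro k i hi hmem
      rw [Finset.mem_erase] at hmem hi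
      by_cases h : i = c
      · subst h
        exact hsh k hmem.2
      · exact hF k i (fun h' => hi ⟨h, h'⟩) hmem.2

theorem Set.mem_of_le_of_forall_add_single_mem {κ : Type*} [Finite κ] [DecidableEq κ]
    {E : Set (κ → ℕ)} (hE : ∀ k, ∀ c ∈ E, c + Pi.single k 1 ∈ E) {a b : κ → ℕ} (ha : a ∈ E)
    (hab : a ≤ b) : b ∈ E := by
  have := Fintype.ofFinite κ
  induction hn : ∑ i, (b i - a i) generalizing a with
  | zero =>
    rw [Finset.sum_eq_zero_iff] at hn
    have : b = a := by
      ext i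
      have h1 := hn i (Finset.mem_univ i)
      have h2 : a i ≤ b i := hab i
      omega
    rwa [this]
  | succ n ih =>
    obtain ⟨k, -, hk⟩ : ∃ k ∈ Finset.univ, b k - a k ≠ 0 := by
      by_contra! h
      rw [Finset.sum_eq_zero h] at hn
      omega
    refine ih (hE k a ha) ?_ ?_
    · intro i
      by_cases h : i = k
      · subst h
        simp
        omega
      · simpa [h] using hab i
    · have h1 : ∀ i, b i - a i = (b i - (a + Pi.single k 1 : κ → ℕ) i) + (Pi.single k 1 : κ → ℕ) i := by
        intro i
        by_cases h : i = k
        · subst h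
          simp
          omega
        · simp [h]
      rw [Finset.sum_congr rfl (fun i _ => h1 i), Finset.sum_add_distrib] at hn
      simpa using hn

theorem mem_span_range_of_smul_prod_pow_mem {κ : Type*} [Fintype κ] [DecidableEq κ] (x : κ → R)
    (hx : ∀ (j : κ) (e : κ → ℕ), (∀ i, 1 ≤ e i) → ∀ r : R,
      x j * r ∈ Ideal.span ((fun i => x i ^ e i) '' {j}ᶜ) →
        r ∈ Ideal.span ((fun i => x i ^ e i) '' {j}ᶜ))
    (E : Set (κ → ℕ)) (hE : ∀ k, ∀ c ∈ E, c + Pi.single k 1 ∈ E) (c : κ → ℕ) (hc : c ∉ E) (r : R)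
    (hr : r • (∏ i, x i ^ c i) ∈ Submodule.span R ((fun a : κ → ℕ => ∏ i, x i ^ a i) '' E)) :
    r ∈ Ideal.span (Set.range x) := by
  refine mem_span_range_of_mul_prod_mem x hx c r ?_
  have hle : Submodule.span R ((fun a : κ → ℕ => ∏ i, x i ^ a i) '' E) ≤
      Ideal.span (Set.range fun i => x i ^ (c i + 1)) := by
    rw [Submodule.span_le]
    rintro _ ⟨a, ha, rfl⟩
    -- E is closed upwards and misses c, so no exponent of E lies below c.
    obtain ⟨i, hi⟩ : ∃ i, c i + 1 ≤ a i := by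
      by_contra! h
      exact hc (Set.mem_of_le_of_forall_add_single_mem hE ha fun i => Nat.lt_succ_iff.mp (h i))
    have hdvd : x i ^ (c i + 1) ∣ ∏ i, x i ^ a i :=
      (pow_dvd_pow _ hi).trans (Finset.dvd_prod_of_mem _ (Finset.mem_univ i))
    exact Ideal.mem_of_dvd _ hdvd (Ideal.subset_span ⟨i, rfl⟩)
  exact hle hr

/-- Taking degree at least n, rather than exactly n, makes the exponent set closed under shifts, as
the filtration requires. -/
theorem Ideal.span_range_pow_eq_span_monomials {κ : Type*} [Fintype κ] [DecidableEq κ]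
    (x : κ → R) (n : ℕ) :
    Ideal.span (Set.range x) ^ n =
      Submodule.span R ((fun a : κ → ℕ => ∏ i, x i ^ a i) '' {a | n ≤ ∑ i, a i}) := by
  apply le_antisymm
  · induction n with
    | zero =>
      rw [pow_zero, Ideal.one_eq_top, top_le_iff, Ideal.eq_top_iff_one]
      exact Submodule.subset_span ⟨0, by simp, by simp⟩
    | succ n ih =>
      rw [pow_succ]
      refine (Ideal.mul_mono_left ih).trans ?_
      rw [← Ideal.span, Ideal.span_mul_span', Ideal.span_le]
      rintro _ ⟨_, ⟨a, ha, rfl⟩, _, ⟨k, rfl⟩, rfl⟩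
      refine Submodule.subset_span ⟨a + Pi.single k 1, ?_, ?_⟩
      · simp only [Set.mem_ofPred_eq] at ha ⊢
        simp [Finset.sum_add_distrib, ha]
      · simp only [Pi.add_apply, pow_add, Finset.prod_mul_distrib]
        congr 1
        rw [Finset.prod_eq_single k] <;> simp +contextual
  · rw [Submodule.span_le]
    rintro _ ⟨a, ha, rfl⟩
    refine Ideal.pow_le_pow_right ha ?_
    rw [← Finset.prod_pow_eq_pow_sum]
    exact Ideal.prod_mem_prod fun i _ => Ideal.pow_mem_pow (Ideal.subset_span (Set.mem_range_self i)) _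

end MonomialFiltration

/-! ### The monomial filtration of the Rees algebra. -/

section ReesAlgebra

variable {R : Type*} [CommRing R] {κ : Type*} [Fintype κ] [DecidableEq κ]

theorem Module.length_quotient_span_range_pow (x : κ → R)
    (hx : ∀ (j : κ) (e : κ → ℕ), (∀ i, 1 ≤ e i) → ∀ r : R,
      x j * r ∈ Ideal.span ((fun i => x i ^ e i) '' {j}ᶜ) →
        r ∈ Ideal.span ((fun i => x i ^ e i) '' {j}ᶜ))
    (n : ℕ) (F : Finset (κ → ℕ)) (hF : ∀ a, a ∈ F ↔ ∑ i, a i < n) :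
    Module.length R (R ⧸ Ideal.span (Set.range x) ^ n) =
      F.card * Module.length R (R ⧸ Ideal.span (Set.range x)) := by
  have hFc : (F : Set (κ → ℕ))ᶜ = {a | n ≤ ∑ i, a i} := by
    ext a
    simp [hF]
  rw [Ideal.span_range_pow_eq_span_monomials, ← hFc]
  refine Module.length_quotient_span_image_monomials (fun a : κ → ℕ => ∏ i, x i ^ a i) x
    (fun k a => a + Pi.single k 1) (fun a => ∑ i, a i) ?_ ?_ ?_ ?_ F ?_
  · intro k c
    simp only [Pi.add_apply, pow_add, Finset.prod_mul_distrib, smul_eq_mul]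
    rw [mul_comm]
    congr 1
    rw [Finset.prod_eq_single k] <;> simp +contextual
  · intro k c
    simp [Finset.sum_add_distrib]
  · intro E hE c hc r hr
    exact mem_span_range_of_smul_prod_pow_mem x hx E hE c hc r hr
  · rw [eq_top_iff]
    intro r _
    have h1 : (1 : R) ∈ Submodule.span R (Set.range fun a : κ → ℕ => ∏ i, x i ^ a i) :=
      Submodule.subset_span ⟨0, by simp⟩
    simpa using Submodule.smul_mem _ r h1
  · intro k c hc
    rw [hF, not_lt] at hc ⊢
    simp only [Pi.add_apply, Finset.sum_add_distrib]
    omega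

/-- The monomial `x ^ a t ^ n` of the Rees algebra of `(x)`, where `n ≤ |a|`. -/
noncomputable def reesMonomial (x : κ → R) (c : {p : (κ → ℕ) × ℕ // p.2 ≤ ∑ i, p.1 i}) :
    reesAlgebra (Ideal.span (Set.range x)) :=
  ⟨Polynomial.monomial c.1.2 (∏ i, x i ^ c.1.1 i), by
    rw [reesAlgebra.monomial_mem, Ideal.span_range_pow_eq_span_monomials]
    exact Submodule.subset_span (Set.mem_image_of_mem _ c.2)⟩

theorem span_range_reesMonomial (x : κ → R) :
    Submodule.span R (Set.range (reesMonomial x)) = ⊤ := by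
  set J := Ideal.span (Set.range x) with hJ
  have hmap : (Submodule.span R (Set.range (reesMonomial x))).map (reesAlgebra J).val.toLinearMap =
      Submodule.span R (Set.range fun c => (reesMonomial x c : Polynomial R)) := by
    rw [Submodule.map_span, ← Set.range_comp]
    rfl
  rw [eq_top_iff]
  rintro ⟨p, hp⟩ -
  suffices h : p ∈ (Submodule.span R (Set.range (reesMonomial x))).map
      (reesAlgebra J).val.toLinearMap by
    obtain ⟨q, hq, hqp⟩ := h
    have : q = ⟨p, hp⟩ := Subtype.ext hqp
    rwa [← this]
  rw [hmap, p.as_sum_support]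
  refine Submodule.sum_mem _ fun n _ => ?_
  have hle : J ^ n ≤ (Submodule.span R (Set.range fun c => (reesMonomial x c : Polynomial R))).comap
      (Polynomial.monomial n) := by
    rw [hJ, Ideal.span_range_pow_eq_span_monomials, Submodule.span_le]
    rintro _ ⟨a, ha, rfl⟩
    exact Submodule.subset_span ⟨⟨(a, n), ha⟩, rfl⟩
  exact hle (hp n)

/-- The set of the exponents of the monomials of the ideal
`(x₁ ^ s, …, x_d ^ s, (x₁ t) ^ s, …, (x_d t) ^ s)` of the Rees algebra. -/
def reesBracketExponents (κ : Type*) [Fintype κ] (s : ℕ) :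
    Set {p : (κ → ℕ) × ℕ // p.2 ≤ ∑ i, p.1 i} :=
  {c | ∃ i, s ≤ c.1.1 i ∧ (c.1.2 + s ≤ ∑ i, c.1.1 i ∨ s ≤ c.1.2)}

theorem prod_pow_add_single (x : κ → R) (a : κ → ℕ) (k : κ) (s : ℕ) :
    ∏ i, x i ^ (a + Pi.single k s : κ → ℕ) i = x k ^ s * ∏ i, x i ^ a i := by
  simp only [Pi.add_apply, pow_add, Finset.prod_mul_distrib]
  rw [mul_comm]
  congr 1
  rw [Finset.prod_eq_single k] <;> simp +contextual

theorem coe_reesGenerators_inl_pow_mul {R κ : Type*} [CommRing R] (x : κ → R) (k : κ) (s : ℕ)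
    (p : reesAlgebra (Ideal.span (Set.range x))) :
    ((reesGenerators x (Sum.inl k) ^ s * p : reesAlgebra (Ideal.span (Set.range x))) :
      Polynomial R) = Polynomial.C (x k ^ s) * p := by
  simp [reesGenerators, Polynomial.C_pow]

theorem coe_reesGenerators_inr_pow_mul {R κ : Type*} [CommRing R] (x : κ → R) (k : κ) (s : ℕ)
    (p : reesAlgebra (Ideal.span (Set.range x))) :
    ((reesGenerators x (Sum.inr k) ^ s * p : reesAlgebra (Ideal.span (Set.range x))) :
      Polynomial R) = Polynomial.monomial s (x k ^ s) * p := by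
  simp [reesGenerators, reesDegreeOne, Polynomial.monomial_pow]

theorem reesGenerators_inl_pow_mul_reesMonomial (x : κ → R) (k : κ) (s : ℕ) (a : κ → ℕ) (n : ℕ)
    (h : n ≤ ∑ i, a i) (h' : n ≤ ∑ i, (a + Pi.single k s : κ → ℕ) i) :
    reesGenerators x (Sum.inl k) ^ s * reesMonomial x ⟨(a, n), h⟩ =
      reesMonomial x ⟨(a + Pi.single k s, n), h'⟩ := by
  apply Subtype.ext
  rw [coe_reesGenerators_inl_pow_mul]
  simp only [reesMonomial, Polynomial.C_mul_monomial, prod_pow_add_single]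

theorem reesGenerators_inr_pow_mul_reesMonomial (x : κ → R) (k : κ) (s : ℕ) (a : κ → ℕ) (n : ℕ)
    (h : n ≤ ∑ i, a i) (h' : s + n ≤ ∑ i, (a + Pi.single k s : κ → ℕ) i) :
    reesGenerators x (Sum.inr k) ^ s * reesMonomial x ⟨(a, n), h⟩ =
      reesMonomial x ⟨(a + Pi.single k s, s + n), h'⟩ := by
  apply Subtype.ext
  rw [coe_reesGenerators_inr_pow_mul]
  simp only [reesMonomial, Polynomial.monomial_mul_monomial, prod_pow_add_single]

/-- Multiplication by x_k^s or (x_k t)^s permits exactly the two alternatives of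
`reesBracketExponents`: after s is subtracted from a_k, the remaining t-degree, n or n - s, must not
exceed |a| - s. -/
theorem restrictScalars_bracketPower_reesGenerators (x : κ → R) (s : ℕ) :
    (bracketPower (reesGenerators x) s).restrictScalars R =
      Submodule.span R (reesMonomial x '' reesBracketExponents κ s) := by
  have hsum : ∀ (a : κ → ℕ) k, ∑ i, (a + Pi.single k s : κ → ℕ) i = ∑ i, a i + s := by
    intro a k
    simp [Finset.sum_add_distrib]
  have hmul : ∀ (g : κ ⊕ κ) (p : reesAlgebra (Ideal.span (Set.range x))),
      reesGenerators x g ^ s * p ∈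
        Submodule.span R (reesMonomial x '' reesBracketExponents κ s) := by
    intro g p
    have hp : p ∈ Submodule.span R (Set.range (reesMonomial x)) := by
      rw [span_range_reesMonomial]
      trivial
    induction hp using Submodule.span_induction with
    | zero => rw [mul_zero]; exact Submodule.zero_mem _
    | add p q _ _ hp hq => rw [mul_add]; exact Submodule.add_mem _ hp hq
    | smul r p _ hp => rw [mul_smul_comm]; exact Submodule.smul_mem _ r hp
    | mem p hp =>
      obtain ⟨⟨⟨a, n⟩, h⟩, rfl⟩ := hp
      simp only at h
      rcases g with k | k
      · have h' : n ≤ ∑ i, (a + Pi.single k s : κ → ℕ) i := by rw [hsum]; omega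
        rw [reesGenerators_inl_pow_mul_reesMonomial x k s a n h h']
        refine Submodule.subset_span (Set.mem_image_of_mem _ ⟨k, by simp, Or.inl ?_⟩)
        simp only
        rw [hsum]
        omega
      · have h' : s + n ≤ ∑ i, (a + Pi.single k s : κ → ℕ) i := by rw [hsum]; omega
        rw [reesGenerators_inr_pow_mul_reesMonomial x k s a n h h']
        exact Submodule.subset_span (Set.mem_image_of_mem _ ⟨k, by simp, Or.inr (by simp)⟩)
  apply le_antisymm
  · intro p hp
    rw [Submodule.restrictScalars_mem, bracketPower] at hp
    induction hp using Submodule.span_induction with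
    | zero => exact Submodule.zero_mem _
    | add p q _ _ hp hq => exact Submodule.add_mem _ hp hq
    | mem p hp =>
      obtain ⟨g, rfl⟩ := hp
      simpa using hmul g 1
    | smul q p hp' hp =>
      clear hp
      rw [smul_eq_mul]
      induction hp' using Submodule.span_induction generalizing q with
      | zero => rw [mul_zero]; exact Submodule.zero_mem _
      | add p p' _ _ hp hq => rw [mul_add]; exact Submodule.add_mem _ (hp q) (hq q)
      | mem p hp =>
        obtain ⟨g, rfl⟩ := hp
        rw [mul_comm]
        exact hmul g q
      | smul q' p _ hp =>
        rw [smul_eq_mul, ← mul_assoc]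
        exact hp (q * q')
  · rw [Submodule.span_le]
    rintro _ ⟨⟨⟨a, n⟩, h⟩, ⟨k, hk, hor⟩, rfl⟩
    simp only at h hk hor
    have hgen : ∀ (g : κ ⊕ κ) (p : reesAlgebra (Ideal.span (Set.range x))),
        reesGenerators x g ^ s * p ∈ bracketPower (reesGenerators x) s := fun g p =>
      Ideal.mul_mem_right _ _ (Ideal.subset_span (Set.mem_range_self g))
    obtain ⟨b, rfl⟩ : ∃ b : κ → ℕ, a = b + Pi.single k s := by
      refine ⟨a - Pi.single k s, ?_⟩
      ext i
      by_cases hi : i = k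
      · subst hi
        simp
        omega
      · simp [hi]
    rw [hsum] at hor
    rcases hor with h1 | h1
    · have h2 : n ≤ ∑ i, b i := by omega
      have := reesGenerators_inl_pow_mul_reesMonomial x k s b n h2 h
      rw [← this]
      exact hgen _ _
    · obtain ⟨n, rfl⟩ := Nat.exists_eq_add_of_le h1
      have h2 : n ≤ ∑ i, b i := by
        have := h
        rw [hsum] at this
        omega
      have := reesGenerators_inr_pow_mul_reesMonomial x k s b n h2 h
      rw [← this]
      exact hgen _ _

/-- Only the shifts by x_k are used, not those by x_k t: the filtration is one of R-modules, with
quotients R/(x). -/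
theorem generalizedHK_reesGenerators (x : κ → R)
    (hx : ∀ (j : κ) (e : κ → ℕ), (∀ i, 1 ≤ e i) → ∀ r : R,
      x j * r ∈ Ideal.span ((fun i => x i ^ e i) '' {j}ᶜ) →
        r ∈ Ideal.span ((fun i => x i ^ e i) '' {j}ᶜ))
    (s : ℕ) (F : Finset {p : (κ → ℕ) × ℕ // p.2 ≤ ∑ i, p.1 i})
    (hF : ∀ c, c ∈ F ↔ c ∉ reesBracketExponents κ s) :
    generalizedHK R (reesGenerators x) s =
      F.card * Module.length R (R ⧸ Ideal.span (Set.range x)) := by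
  have hFc : (F : Set {p : (κ → ℕ) × ℕ // p.2 ≤ ∑ i, p.1 i})ᶜ = reesBracketExponents κ s := by
    ext a
    simp [hF]
  have e := (Submodule.Quotient.restrictScalarsEquiv R (bracketPower (reesGenerators x) s))
  unfold generalizedHK
  rw [← e.length_eq, restrictScalars_bracketPower_reesGenerators, ← hFc]
  refine Module.length_quotient_span_image_monomials (reesMonomial x) x
    (fun k c => ⟨(c.1.1 + Pi.single k 1, c.1.2), by
      have := c.2
      simp only [Pi.add_apply, Finset.sum_add_distrib]
      omega⟩) (fun c => ∑ i, c.1.1 i) ?_ ?_ ?_ (span_range_reesMonomial x) F ?_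
  · rintro k ⟨⟨a, n⟩, h⟩
    apply Subtype.ext
    change Polynomial.monomial n _ = x k • Polynomial.monomial n _
    rw [prod_pow_add_single, pow_one, Polynomial.smul_monomial, smul_eq_mul]
  · intro k c
    simp [Finset.sum_add_distrib]
  · rintro E hE ⟨⟨a, n⟩, h⟩ hc r hr
    -- Taking the coefficient of t^n reduces the colon condition to the one for monomials in R.
    let f : reesAlgebra (Ideal.span (Set.range x)) →ₗ[R] R :=
      (Polynomial.lcoeff R n).comp (reesAlgebra (Ideal.span (Set.range x))).val.toLinearMap
    have hfm : ∀ c, f (reesMonomial x c) = if c.1.2 = n then ∏ i, x i ^ c.1.1 i else 0 := by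
      intro c
      exact Polynomial.coeff_monomial
    refine mem_span_range_of_smul_prod_pow_mem x hx
      {b | ∃ h : n ≤ ∑ i, b i, (⟨(b, n), h⟩ : {p : (κ → ℕ) × ℕ // p.2 ≤ ∑ i, p.1 i}) ∈ E} ?_ a ?_ r ?_
    · rintro k b ⟨h, hb⟩
      exact ⟨_, hE k _ hb⟩
    · rintro ⟨_, h'⟩
      exact hc h'
    · have h1 := Submodule.mem_map_of_mem (f := f) hr
      rw [map_smul, hfm, if_pos rfl, Submodule.map_span] at h1
      refine Submodule.span_le.mpr ?_ h1
      rintro _ ⟨_, ⟨⟨⟨b, n'⟩, hb⟩, hbE, rfl⟩, rfl⟩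
      rw [hfm]
      split_ifs with hn
      · simp only at hn
        subst hn
        exact Submodule.subset_span ⟨b, ⟨hb, hbE⟩, rfl⟩
      · exact Submodule.zero_mem _
  · rintro k ⟨⟨a, n⟩, h⟩ hc
    rw [hF, not_not] at hc ⊢
    obtain ⟨i, hi, hor⟩ := hc
    refine ⟨i, ?_, ?_⟩
    · simp only [Pi.add_apply] at hi ⊢
      omega
    · simp only [Pi.add_apply, Finset.sum_add_distrib] at hor ⊢
      omega

end ReesAlgebra

/-! ### Counting the monomials outside the bracket ideal. -/

section Counting

/-- The finite set of the vectors of natural numbers with sum less than `n`. -/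
def sumLT (d n : ℕ) : Finset (Fin d → ℕ) :=
  (Finset.range n).biUnion fun k => Finset.piAntidiag Finset.univ k

theorem mem_sumLT {d n : ℕ} {a : Fin d → ℕ} : a ∈ sumLT d n ↔ ∑ i, a i < n := by
  simp [sumLT, Finset.mem_piAntidiag]

theorem sum_range_choose_add_sub_one (d n : ℕ) (hd : 1 ≤ d) :
    ∑ k ∈ Finset.range n, (k + d - 1).choose d = (n + d - 1).choose (d + 1) := by
  obtain ⟨e, rfl⟩ := Nat.exists_eq_add_of_le' hd
  induction n with
  | zero =>
    rw [Finset.sum_range_zero, Nat.choose_eq_zero_of_lt (by omega)]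
  | succ n ih =>
    rw [Finset.sum_range_succ, ih]
    have h1 : n + 1 + (e + 1) - 1 = (n + (e + 1) - 1) + 1 := by omega
    rw [h1, Nat.choose_succ_succ, add_comm]

theorem card_sumLT (d n : ℕ) (hd : 1 ≤ d) : (sumLT d n).card = (n + d - 1).choose d := by
  rw [sumLT, Finset.card_biUnion]
  · obtain ⟨e, rfl⟩ := Nat.exists_eq_add_of_le' hd
    induction n with
    | zero => simp
    | succ n ih =>
      have h0 := Finset.card_finsuppAntidiag_nat_eq_choose
        (s := (Finset.univ : Finset (Fin (e + 1)))) n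
      rw [Finset.finsuppAntidiag, Finset.card_map, Finset.card_attach] at h0
      rw [Finset.sum_range_succ, ih, h0]
      have h1 : n + 1 + (e + 1) - 1 = (n + e) + 1 := by omega
      have h2 : n + (e + 1) - 1 = n + e := by omega
      simp only [Finset.card_univ, Fintype.card_fin]
      rw [h1, h2, Nat.choose_succ_succ, add_comm]
      rw [show e + 1 + n - 1 = n + e by omega, ← Nat.choose_symm_add]
  · intro i _ j _ hij
    rw [Function.onFun, Finset.disjoint_left]
    intro a ha hb
    simp only [Finset.mem_piAntidiag] at ha hb
    exact hij (ha.1.symm.trans hb.1)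

theorem two_mul_sum_piFinset_range_sum (d s : ℕ) :
    2 * ∑ a ∈ Fintype.piFinset (fun _ : Fin d => Finset.range s), ∑ i, a i = d * (s - 1) * s ^ d := by
  -- The reflection a_i ↦ s - 1 - a_i of the box: a vector and its mirror image have total d(s - 1).
  have h : ∑ a ∈ Fintype.piFinset (fun _ : Fin d => Finset.range s), ∑ i, a i =
      ∑ a ∈ Fintype.piFinset (fun _ : Fin d => Finset.range s), ∑ i, (s - 1 - a i) := by
    refine Finset.sum_nbij' (fun a i => s - 1 - a i) (fun a i => s - 1 - a i) ?_ ?_ ?_ ?_ ?_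
    all_goals
      intro a ha
      rw [Fintype.mem_piFinset] at ha
      simp only [Finset.mem_range] at ha
    · rw [Fintype.mem_piFinset]
      intro i
      have := ha i
      simp only [Finset.mem_range]
      omega
    · rw [Fintype.mem_piFinset]
      intro i
      have := ha i
      simp only [Finset.mem_range]
      omega
    · ext i
      have := ha i
      simp only
      omega
    · ext i
      have := ha i
      simp only
      omega
    · refine Finset.sum_congr rfl fun i _ => ?_
      have := ha i
      simp only
      omega
  rw [two_mul]
  conv_lhs => arg 2; rw [h]
  rw [← Finset.sum_add_distrib, Finset.sum_congr rfl (g := fun _ => d * (s - 1))]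
  · simp [mul_comm]
  · intro a ha
    rw [Fintype.mem_piFinset] at ha
    rw [← Finset.sum_add_distrib, Finset.sum_congr rfl (g := fun _ => s - 1)]
    · simp
    · intro i _
      have := ha i
      simp only [Finset.mem_range] at this
      omega

/-- The pairs `(a, n)` with `n ≤ |a|` and all the entries of `a` less than `s`. -/
def boxPairs (d s : ℕ) : Finset ((Fin d → ℕ) × ℕ) :=
  (Fintype.piFinset fun _ : Fin d => Finset.range s).biUnion
    fun a => {a} ×ˢ Finset.range (∑ i, a i + 1)

/-- The pairs `(a, n)` with `|a| - s < n < s` and the `k`-th entry of `a` at least `s`. -/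
def cornerPairs (d s : ℕ) (k : Fin d) : Finset ((Fin d → ℕ) × ℕ) :=
  ((Finset.range s).biUnion fun n => sumLT d n ×ˢ {n}).image
    fun c => (c.1 + Pi.single k s, c.2)

theorem mem_boxPairs {d s : ℕ} {c : (Fin d → ℕ) × ℕ} :
    c ∈ boxPairs d s ↔ (∀ i, c.1 i < s) ∧ c.2 ≤ ∑ i, c.1 i := by
  obtain ⟨a, n⟩ := c
  simp only [boxPairs, Finset.mem_biUnion, Fintype.mem_piFinset, Finset.mem_range,
    Finset.mem_product, Finset.mem_singleton, Nat.lt_succ_iff]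
  constructor
  · rintro ⟨a, h1, rfl, h2⟩
    exact ⟨h1, h2⟩
  · rintro ⟨h1, h2⟩
    exact ⟨a, h1, rfl, h2⟩

theorem mem_cornerPairs {d s : ℕ} {k : Fin d} {c : (Fin d → ℕ) × ℕ} :
    c ∈ cornerPairs d s k ↔ s ≤ c.1 k ∧ ∑ i, c.1 i < c.2 + s ∧ c.2 < s := by
  obtain ⟨a, n⟩ := c
  have hsum : ∀ b : Fin d → ℕ, ∑ i, (b + Pi.single k s : Fin d → ℕ) i = ∑ i, b i + s := by
    intro b
    simp [Finset.sum_add_distrib]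
  simp only [cornerPairs, Finset.mem_image, Finset.mem_biUnion, Finset.mem_range,
    Finset.mem_product, Finset.mem_singleton, mem_sumLT, Prod.exists, Prod.mk.injEq]
  constructor
  · rintro ⟨b, n, ⟨n', h1, h2, rfl⟩, rfl, rfl⟩
    rw [hsum]
    exact ⟨by simp, by omega, h1⟩
  · rintro ⟨h1, h2, h3⟩
    obtain ⟨b, rfl⟩ : ∃ b : Fin d → ℕ, a = b + Pi.single k s := by
      refine ⟨a - Pi.single k s, ?_⟩
      ext i
      by_cases hi : i = k
      · subst hi
        simp
        omega
      · simp [hi]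
    rw [hsum] at h2
    exact ⟨b, n, ⟨n, h3, by omega, rfl⟩, rfl, rfl⟩

theorem card_boxPairs (d s : ℕ) :
    2 * (boxPairs d s).card = d * (s - 1) * s ^ d + 2 * s ^ d := by
  rw [boxPairs, Finset.card_biUnion]
  · simp only [Finset.card_product, Finset.card_singleton, one_mul, Finset.card_range,
      Finset.sum_add_distrib, mul_add, two_mul_sum_piFinset_range_sum]
    simp
  · intro a _ b _ hab
    rw [Function.onFun, Finset.disjoint_left]
    intro c hc hc'
    simp only [Finset.mem_product, Finset.mem_singleton] at hc hc'
    exact hab (hc.1.symm.trans hc'.1)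

theorem card_cornerPairs (d s : ℕ) (k : Fin d) :
    (cornerPairs d s k).card = (s + d - 1).choose (d + 1) := by
  have hd : 1 ≤ d := k.pos
  rw [cornerPairs, Finset.card_image_of_injective, Finset.card_biUnion]
  · simp only [Finset.card_product, Finset.card_singleton, mul_one, card_sumLT d _ hd]
    exact sum_range_choose_add_sub_one d s hd
  · intro a _ b _ hab
    rw [Function.onFun, Finset.disjoint_left]
    intro c hc hc'
    simp only [Finset.mem_product, Finset.mem_singleton] at hc hc'
    exact hab (hc.2.symm.trans hc'.2)
  · rintro ⟨a, n⟩ ⟨b, m⟩ h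
    simp only [Prod.mk.injEq, add_left_inj] at h
    exact Prod.ext h.1 h.2

theorem exists_finset_compl_reesBracketExponents (d s : ℕ) :
    ∃ F : Finset {p : (Fin d → ℕ) × ℕ // p.2 ≤ ∑ i, p.1 i},
      (∀ c, c ∈ F ↔ c ∉ reesBracketExponents (Fin d) s) ∧
      2 * F.card = d * (s - 1) * s ^ d + 2 * s ^ d + 2 * (d * (s + d - 1).choose (d + 1)) := by
  set G : Finset ((Fin d → ℕ) × ℕ) :=
    boxPairs d s ∪ Finset.univ.biUnion (cornerPairs d s) with hG
  have hsingle : ∀ (a : Fin d → ℕ) k, a k ≤ ∑ i, a i := fun a k =>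
    Finset.single_le_sum (fun i _ => Nat.zero_le (a i)) (Finset.mem_univ k)
  have hGmem : ∀ c ∈ G, c.2 ≤ ∑ i, c.1 i := by
    intro c hc
    rw [hG, Finset.mem_union, Finset.mem_biUnion] at hc
    rcases hc with h | ⟨k, -, h⟩
    · exact (mem_boxPairs.mp h).2
    · obtain ⟨h1, h2, h3⟩ := mem_cornerPairs.mp h
      have := hsingle c.1 k
      omega
  refine ⟨G.subtype _, ?_, ?_⟩
  · rintro ⟨⟨a, n⟩, h⟩
    simp only at h
    simp only [Finset.mem_subtype, hG, Finset.mem_union, mem_boxPairs, Finset.mem_biUnion,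
      Finset.mem_univ, true_and, mem_cornerPairs, reesBracketExponents, Set.mem_ofPred_eq]
    push Not
    constructor
    · rintro (⟨h1, -⟩ | ⟨k, h1, h2, h3⟩) i hi
      · exact absurd (h1 i) (by omega)
      · exact ⟨h2, h3⟩
    · intro h1
      by_cases h2 : ∀ i, a i < s
      · exact Or.inl ⟨h2, h⟩
      · push Not at h2
        obtain ⟨k, hk⟩ := h2
        exact Or.inr ⟨k, hk, h1 k hk⟩
  · rw [Finset.card_subtype, Finset.filter_true_of_mem hGmem, hG, Finset.card_union_of_disjoint,
      Finset.card_biUnion, mul_add, card_boxPairs]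
    · simp only [card_cornerPairs]
      simp
    · intro k _ l _ hkl
      rw [Function.onFun, Finset.disjoint_left]
      intro c hc hc'
      obtain ⟨h1, h2, h3⟩ := mem_cornerPairs.mp hc
      obtain ⟨h4, -, -⟩ := mem_cornerPairs.mp hc'
      -- Two entries at least s would give |a| ≥ 2s, against |a| < n + s < 2s.
      have : c.1 k + c.1 l ≤ ∑ i, c.1 i := by
        rw [← Finset.sum_pair hkl]
        exact Finset.sum_le_sum_of_subset (Finset.subset_univ _)
      omega
    · rw [Finset.disjoint_left]
      intro c hc hc'
      obtain ⟨k, -, h⟩ := Finset.mem_biUnion.mp hc'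
      have h1 := (mem_boxPairs.mp hc).1 k
      have h2 := (mem_cornerPairs.mp h).1
      omega

end Counting

/-! ### Leading coefficients and limits. -/

section Asymptotics

theorem tendsto_factorial_mul_choose_div_pow (d : ℕ) (L : ℝ) :
    Tendsto (fun n : ℕ => (d.factorial : ℝ) * (((n + d - 1).choose d : ℝ) * L) / (n : ℝ) ^ d)
      atTop (𝓝 L) := by
  have h1 : Tendsto (fun y : ℝ => (ascPochhammer ℝ d).eval y / (Polynomial.X ^ d : Polynomial ℝ).eval y)
      atTop (𝓝 ((ascPochhammer ℝ d).leadingCoeff / (Polynomial.X ^ d : Polynomial ℝ).leadingCoeff)) := by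
    apply Polynomial.div_tendsto_atTop_leadingCoeff_div_of_degree_eq
    rw [Polynomial.degree_X_pow, Polynomial.degree_eq_natDegree (monic_ascPochhammer ℝ d).ne_zero,
      ascPochhammer_natDegree]
  rw [(monic_ascPochhammer ℝ d).leadingCoeff, Polynomial.leadingCoeff_X_pow, div_one] at h1
  have h2 := (h1.comp tendsto_natCast_atTop_atTop).mul_const L
  rw [one_mul] at h2
  refine h2.congr fun n => ?_
  have h3 : (ascPochhammer ℝ d).eval (n : ℝ) = (d.factorial : ℝ) * ((n + d - 1).choose d : ℝ) := by
    rw [← Nat.cast_mul, ← Nat.ascFactorial_eq_factorial_mul_choose',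
      ← ascPochhammer_nat_eq_ascFactorial, ascPochhammer_eval_cast]
  simp only [Function.comp_apply, h3, Polynomial.eval_pow, Polynomial.eval_X]
  ring

theorem hilbertSamuelMultiplicity_eq_of_length {R : Type*} [CommRing R] {d : ℕ}
    (hdim : ringKrullDim R = d) (I : Ideal R) (L : ℕ)
    (h : ∀ n : ℕ, Module.length R (R ⧸ I ^ n) = ((n + d - 1).choose d : ℕ) * (L : ℕ∞)) :
    hilbertSamuelMultiplicity I = L := by
  have hk : krullDimNat R = d := by
    simp only [krullDimNat, hdim]
    rfl
  refine Tendsto.limUnder_eq ?_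
  rw [hk]
  refine (tendsto_factorial_mul_choose_div_pow d L).congr fun n => ?_
  rw [h, show (((n + d - 1).choose d : ℕ) : ℕ∞) * (L : ℕ∞) = (((n + d - 1).choose d * L : ℕ) : ℕ∞) by
    push_cast; rfl, ENat.toNat_natCast, Nat.cast_mul]

/-- The elementary symmetric functions of 0, …, n+1 in degrees 0, 1, 2, by the recursion given by
the factor X + (n + 2). -/
theorem coeff_ascPochhammer (n : ℕ) :
    (ascPochhammer ℝ (n + 2)).coeff (n + 2) = 1 ∧
    (ascPochhammer ℝ (n + 2)).coeff (n + 1) = ((n : ℝ) + 2) * (n + 1) / 2 ∧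
    (ascPochhammer ℝ (n + 2)).coeff n = ((n : ℝ) + 2) * (n + 1) * n * (3 * n + 5) / 24 := by
  induction n with
  | zero =>
    have h : ascPochhammer ℝ (0 + 2) = Polynomial.X ^ 2 + Polynomial.X := by
      rw [show 0 + 2 = 1 + 1 by rfl, ascPochhammer_succ_right, ascPochhammer_one]
      simp
      ring
    rw [h]
    simp [Polynomial.coeff_X]
  | succ n ih =>
    obtain ⟨h1, h2, h3⟩ := ih
    have h4 : (ascPochhammer ℝ (n + 2)).coeff (n + 3) = 0 := by
      apply Polynomial.coeff_eq_zero_of_natDegree_lt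
      rw [ascPochhammer_natDegree]
      omega
    have h : ∀ k, (ascPochhammer ℝ (n + 1 + 2)).coeff (k + 1) =
        (ascPochhammer ℝ (n + 2)).coeff k + (ascPochhammer ℝ (n + 2)).coeff (k + 1) * (n + 2) := by
      intro k
      rw [show n + 1 + 2 = (n + 2) + 1 by ring, ascPochhammer_succ_right, mul_add,
        Polynomial.coeff_add, Polynomial.coeff_mul_X, ← Polynomial.C_eq_natCast,
        Polynomial.coeff_mul_C]
      push_cast
      ring
    rw [show n + 1 + 2 = (n + 2) + 1 by ring] at *
    refine ⟨?_, ?_, ?_⟩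
    · rw [h, h1, h4]; ring
    · rw [h, h1, h2]; push_cast; ring
    · rw [h, h2, h3]; push_cast; ring

theorem exists_polynomial_hilbertKunz (d : ℕ) (hd : 2 ≤ d) (e : ℝ) (he : e ≠ 0) :
    ∃ P : Polynomial ℝ, P.natDegree = d + 1 ∧
      P.coeff (d + 1) = hkConstant d * e ∧
      P.coeff d = e * (((d : ℝ) - 2) / 2) * (1 / ((d - 1).factorial : ℝ) - 1) ∧
      P.coeff (d - 1) =
        e * ((d : ℝ) * ((d : ℝ) - 1) * (3 * (d : ℝ) - 10) / (24 * ((d - 1).factorial : ℝ))) ∧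
      ∀ s : ℕ, 1 ≤ s → P.eval (s : ℝ) =
        e * ((d : ℝ) * (s : ℝ) ^ (d + 1) / 2 - (s : ℝ) ^ d * ((d : ℝ) - 2) / 2
            + (d : ℝ) * ((s + d - 1).choose (d + 1) : ℝ)) := by
  obtain ⟨n, rfl⟩ := Nat.exists_eq_add_of_le' hd
  obtain ⟨h1, h2, h3⟩ := coeff_ascPochhammer n
  have h4 : (ascPochhammer ℝ (n + 2)).coeff (n + 3) = 0 := by
    apply Polynomial.coeff_eq_zero_of_natDegree_lt
    rw [ascPochhammer_natDegree]
    omega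
  have e1 : n + 2 - 1 = n + 1 := by omega
  simp only [e1]
  have hf2 : (((n + 2 + 1).factorial : ℕ) : ℝ) =
      ((n : ℝ) + 3) * (n + 2) * ((n + 1).factorial : ℕ) := by
    rw [Nat.factorial_succ, Nat.factorial_succ]
    push_cast
    ring
  -- With d = n + 2, (d+1)! C(s+d-1, d+1) = (s-1)s(s+1)⋯(s+d-1), which is Q(s).
  set Q : Polynomial ℝ := ascPochhammer ℝ (n + 2) * (Polynomial.X - Polynomial.C 1) with hQ
  have hQc : ∀ k, Q.coeff (k + 1) =
      (ascPochhammer ℝ (n + 2)).coeff k - (ascPochhammer ℝ (n + 2)).coeff (k + 1) := by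
    intro k
    rw [hQ, mul_sub, Polynomial.coeff_sub, Polynomial.coeff_mul_X, Polynomial.coeff_mul_C, mul_one]
  set P : Polynomial ℝ := Polynomial.C (e * ((n : ℝ) + 2) / 2) * Polynomial.X ^ (n + 3)
    - Polynomial.C (e * (n : ℝ) / 2) * Polynomial.X ^ (n + 2)
    + Polynomial.C (e * ((n : ℝ) + 2) / ((n + 2 + 1).factorial : ℝ)) * Q with hP
  have hPc : ∀ k, P.coeff k = e * ((n : ℝ) + 2) / 2 * (if k = n + 3 then 1 else 0)
      - e * (n : ℝ) / 2 * (if k = n + 2 then 1 else 0)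
      + e * ((n : ℝ) + 2) / ((n + 2 + 1).factorial : ℝ) * Q.coeff k := by
    intro k
    simp only [hP, Polynomial.coeff_add, Polynomial.coeff_sub, Polynomial.coeff_C_mul,
      Polynomial.coeff_X_pow]
  have hc : P.coeff (n + 2 + 1) = hkConstant (n + 2) * e := by
    rw [hPc, hQc, h1, h4, hkConstant]
    simp
    ring
  refine ⟨P, ?_, hc, ?_, ?_, ?_⟩
  · apply le_antisymm
    · rw [Polynomial.natDegree_le_iff_coeff_eq_zero]
      intro k hk
      obtain ⟨k, rfl⟩ := Nat.exists_eq_add_of_lt hk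
      rw [hPc, hQc, Polynomial.coeff_eq_zero_of_natDegree_lt,
        Polynomial.coeff_eq_zero_of_natDegree_lt, if_neg (by omega), if_neg (by omega)]
      · ring
      · rw [ascPochhammer_natDegree]; omega
      · rw [ascPochhammer_natDegree]; omega
    · apply Polynomial.le_natDegree_of_ne_zero
      rw [hc]
      refine mul_ne_zero ?_ he
      rw [hkConstant]
      positivity
  · rw [hPc, hQc, h1, h2, if_neg (by omega), if_pos rfl, hf2]
    push_cast
    field_simp
    ring
  · rw [hPc, hQc, h2, h3, if_neg (by omega), if_neg (by omega), hf2]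
    push_cast
    field_simp
    ring
  · intro s hs
    have h5 : Q.eval (s : ℝ) =
        (((n + 2 + 1).factorial : ℕ) : ℝ) * ((s + (n + 2) - 1).choose (n + 2 + 1) : ℝ) := by
      obtain ⟨t, rfl⟩ := Nat.exists_eq_add_of_le' hs
      have h6 : (ascPochhammer ℝ (n + 3)).eval (t : ℝ) =
          (((n + 2 + 1).factorial : ℕ) : ℝ) * ((t + 1 + (n + 2) - 1).choose (n + 2 + 1) : ℝ) := by
        rw [show t + 1 + (n + 2) - 1 = t + (n + 2 + 1) - 1 by omega, ← Nat.cast_mul,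
          ← Nat.ascFactorial_eq_factorial_mul_choose',
          ← ascPochhammer_nat_eq_ascFactorial, ascPochhammer_eval_cast]
      rw [← h6, ascPochhammer_succ_left, hQ]
      simp
      ring
    simp only [hP, Polynomial.eval_add, Polynomial.eval_sub, Polynomial.eval_mul,
      Polynomial.eval_C, Polynomial.eval_pow, Polynomial.eval_X, h5]
    push_cast
    field_simp
    ring

theorem tendsto_eval_div_pow (P : Polynomial ℝ) (n : ℕ) (hP : P.natDegree = n)
    (f : ℕ → ℝ) (N : ℕ) (hf : ∀ s : ℕ, N ≤ s → f s = P.eval (s : ℝ)) (hn : 0 < n) :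
    Tendsto (fun s : ℕ => f s / (s : ℝ) ^ n) atTop (𝓝 (P.coeff n)) := by
  have h0 : P ≠ 0 := by
    rintro rfl
    simp at hP
    omega
  have h1 : Tendsto (fun y : ℝ => P.eval y / (Polynomial.X ^ n : Polynomial ℝ).eval y)
      atTop (𝓝 (P.leadingCoeff / (Polynomial.X ^ n : Polynomial ℝ).leadingCoeff)) := by
    apply Polynomial.div_tendsto_atTop_leadingCoeff_div_of_degree_eq
    rw [Polynomial.degree_X_pow, Polynomial.degree_eq_natDegree h0, hP]
  rw [Polynomial.leadingCoeff_X_pow, div_one, Polynomial.leadingCoeff, hP] at h1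
  refine (h1.comp tendsto_natCast_atTop_atTop).congr' ?_
  filter_upwards [eventually_ge_atTop N] with s hs
  simp [hf s hs]

end Asymptotics

/-! ### Finite differences of binomial coefficients. -/

section BinomialIdentity

open fwdDiff

theorem ringChoose_sub_eq_sum (k s : ℕ) (M : ℤ) :
    Ring.choose (M + (k + 1)) (k + 2) - Ring.choose (M - s + (k + 1)) (k + 2) =
      ∑ a ∈ Finset.range s, Ring.choose (M - a + k) (k + 1) := by
  induction s with
  | zero => simp
  | succ s ih =>
    rw [Finset.sum_range_succ, ← ih]
    have h := Ring.choose_succ_succ (M - s + k : ℤ) (k + 1)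
    have h1 : (M - s + (k + 1) : ℤ) = M - s + k + 1 := by ring
    have h2 : (M - ((s + 1 : ℕ) : ℤ) + (k + 1) : ℤ) = M - s + k := by push_cast; ring
    rw [h1, h2, h]
    ring

/-- A difference of step -s is minus a sum of s binomial coefficients of one degree less, by
telescoping Pascal's rule. This reduces k + 1 to k at the points M - a, a < s. -/
theorem two_mul_fwdDiff_iter_ringChoose (k s : ℕ) (M : ℤ) :
    2 * ((-1) ^ k * (Δ_[-(s : ℤ)])^[k] (fun y : ℤ => Ring.choose (y + k) (k + 1)) M) =
      2 * M * s ^ k - k * s ^ k * (s - 1) := by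
  induction k generalizing M with
  | zero => simp
  | succ k ih =>
    have h1 : Δ_[-(s : ℤ)] (fun y : ℤ => Ring.choose (y + (k + 1 : ℕ)) (k + 1 + 1)) =
        -∑ a ∈ Finset.range s, fun y : ℤ => Ring.choose (y + (-a : ℤ) + k) (k + 1) := by
      funext y
      have := ringChoose_sub_eq_sum k s y
      simp only [fwdDiff, Pi.neg_apply, Finset.sum_apply, ← sub_eq_add_neg]
      rw [← this]
      push_cast
      ring
    have h2 : (Δ_[-(s : ℤ)])^[k] (-∑ a ∈ Finset.range s,
        fun y : ℤ => Ring.choose (y + (-a : ℤ) + k) (k + 1)) M = -∑ a ∈ Finset.range s,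
          (Δ_[-(s : ℤ)])^[k] (fun y : ℤ => Ring.choose (y + k) (k + 1)) (M - a) := by
      have hneg : ∀ f : ℤ → ℤ, (Δ_[-(s : ℤ)])^[k] (-f) M = -(Δ_[-(s : ℤ)])^[k] f M := by
        intro f
        rw [← neg_one_smul ℤ f, fwdDiff_iter_const_smul]
        simp
      rw [hneg, fwdDiff_iter_finsetSum, Finset.sum_apply]
      congr 1
      refine Finset.sum_congr rfl fun a _ => ?_
      exact fwdDiff_iter_comp_add (-(s : ℤ)) (fun y : ℤ => Ring.choose (y + k) (k + 1)) (-a : ℤ) k M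
    rw [Function.iterate_succ_apply, h1, h2]
    have h3 : 2 * ((-1) ^ (k + 1) * -∑ a ∈ Finset.range s,
          (Δ_[-(s : ℤ)])^[k] (fun y : ℤ => Ring.choose (y + k) (k + 1)) (M - a)) =
        ∑ a ∈ Finset.range s, (2 * (M - a) * s ^ k - k * s ^ k * (s - 1) : ℤ) := by
      rw [pow_succ, mul_neg_one, neg_mul_neg, Finset.mul_sum, Finset.mul_sum]
      exact Finset.sum_congr rfl fun a _ => ih _
    rw [h3]
    have h4 : ∀ n : ℕ, ∑ a ∈ Finset.range n, (2 * (M - a) * s ^ k - k * s ^ k * (s - 1) : ℤ) =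
        2 * M * s ^ k * n - s ^ k * n * (n - 1) - k * s ^ k * (s - 1) * n := by
      intro n
      induction n with
      | zero => simp
      | succ n ihn =>
        rw [Finset.sum_range_succ, ihn]
        push_cast
        ring
    rw [h4]
    push_cast
    ring

/-- The d-th difference at M = Ds - 1. Condition `hD` says that the upper entry of the missing term
i = d lies in 0, …, d, so C(m, d+1) = 0. -/
theorem sum_range_neg_one_pow_mul_choose_mul_ringChoose (d s : ℕ) (D : ℤ)
    (hD : ∃ m : ℕ, m ≤ d ∧ (D - d) * s + d - 1 = m) :
    ∑ i ∈ Finset.range d, (-1 : ℝ) ^ i * (d.choose i : ℝ) *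
      ((Ring.choose ((D - i) * s + d - 1) (d + 1) : ℤ) : ℝ) =
        ((D : ℝ) * s - 1) * s ^ d - d * s ^ d * ((s : ℝ) - 1) / 2 := by
  obtain ⟨m, hm, hmD⟩ := hD
  have h1 := two_mul_fwdDiff_iter_ringChoose d s (D * s - 1)
  rw [fwdDiff_iter_eq_sum_shift, Finset.mul_sum, Finset.sum_range_succ] at h1
  have h2 : (D * s - 1 + d • (-(s : ℤ)) + d : ℤ) = m := by
    rw [← hmD, nsmul_eq_mul]
    ring
  rw [h2, Ring.choose_natCast, Nat.choose_eq_zero_of_lt (show m < d + 1 by omega)] at h1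
  have h3 : ∑ i ∈ Finset.range d, ((-1) ^ d * (((-1 : ℤ) ^ (d - i) * (d.choose i : ℤ)) •
      (Ring.choose (D * s - 1 + i • (-(s : ℤ)) + d : ℤ) (d + 1)))) =
      ∑ i ∈ Finset.range d, (-1 : ℤ) ^ i * (d.choose i : ℤ) *
        (Ring.choose ((D - i) * s + d - 1) (d + 1)) := by
    refine Finset.sum_congr rfl fun i hi => ?_
    rw [Finset.mem_range] at hi
    obtain ⟨j, rfl⟩ := Nat.exists_eq_add_of_lt hi
    have h4 : (D * s - 1 + i • (-(s : ℤ)) + (i + j + 1 : ℕ) : ℤ) =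
        (D - i) * s + (i + j + 1 : ℕ) - 1 := by
      rw [nsmul_eq_mul]
      ring
    rw [h4, smul_eq_mul, ← mul_assoc, ← mul_assoc, ← pow_add,
      show i + j + 1 + (i + j + 1 - i) = i + 2 * (j + 1) by omega, pow_add, pow_mul]
    simp
  rw [h3] at h1
  have h5 : (2 : ℝ) * (∑ i ∈ Finset.range d, (-1 : ℝ) ^ i * (d.choose i : ℝ) *
      ((Ring.choose ((D - i) * s + d - 1) (d + 1) : ℤ) : ℝ)) =
        2 * ((D : ℝ) * s - 1) * s ^ d - d * s ^ d * ((s : ℝ) - 1) := by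
    have := congrArg (Int.cast : ℤ → ℝ) h1
    push_cast at this
    rw [← this]
    simp
  linear_combination h5 / 2

end BinomialIdentity

/-! ### The dimension of the Rees algebra. -/

section ReesDimension

theorem MvPolynomial.C_mul_X_sub_C_mul_X_ne_zero {σ F : Type*} [Field F] (i j : σ) (hij : i ≠ j) (a b : F)
    (ha : a ≠ 0) : (MvPolynomial.C a * MvPolynomial.X i - MvPolynomial.C b * MvPolynomial.X j :
      MvPolynomial σ F) ≠ 0 := by
  classical
  intro h
  have := congrArg (MvPolynomial.aeval (Pi.single i (1 : F))) h
  simp [hij.symm] at this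
  exact ha this

/-- The ring homomorphism `R[T] → F[T]` extending `g` that sends `T_l` to
`(g x_l / g x_i) T_i` for `l ∈ U` and to `T_l` for `l ∉ U`. -/
noncomputable def proportionalSubstitution {R F σ : Type*} [CommRing R] [Field F] [DecidableEq σ]
    (g : R →+* F) (x : σ → R) (i : σ) (U : Finset σ) : MvPolynomial σ R →+* MvPolynomial σ F :=
  MvPolynomial.eval₂Hom (MvPolynomial.C.comp g)
    (fun l => if l ∈ U then MvPolynomial.C (g (x l) / g (x i)) * MvPolynomial.X i
      else MvPolynomial.X l)

theorem card_le_height_ker_proportionalSubstitution {R F σ : Type*} [CommRing R] [Field F]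
    [DecidableEq σ] (g : R →+* F) (x : σ → R) (i : σ) (hi : g (x i) ≠ 0) (U : Finset σ)
    (hU : i ∉ U) : (U.card : ℕ∞) ≤ (RingHom.ker (proportionalSubstitution g x i U)).height := by
  induction U using Finset.induction_on with
  | empty => simp
  | insert l U hl ih =>
    rw [Finset.mem_insert, not_or] at hU
    have hcomp : (MvPolynomial.eval₂Hom MvPolynomial.C (fun k => if k = l then
        MvPolynomial.C (g (x l) / g (x i)) * MvPolynomial.X i else MvPolynomial.X k)).comp
          (proportionalSubstitution g x i U) = proportionalSubstitution g x i (insert l U) := by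
      apply MvPolynomial.ringHom_ext
      · intro r
        simp [proportionalSubstitution]
      · intro k
        by_cases hk : k ∈ U
        · simp [proportionalSubstitution, hk, hU.1]
        · by_cases hkl : k = l
          · subst hkl
            simp [proportionalSubstitution, hk]
          · simp [proportionalSubstitution, hk, hkl]
    have hle : RingHom.ker (proportionalSubstitution g x i U) ≤
        RingHom.ker (proportionalSubstitution g x i (insert l U)) := by
      intro a ha
      rw [RingHom.mem_ker] at ha ⊢
      rw [← hcomp, RingHom.comp_apply, ha, map_zero]
    have hlt : RingHom.ker (proportionalSubstitution g x i U) <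
        RingHom.ker (proportionalSubstitution g x i (insert l U)) := by
      refine lt_of_le_of_ne hle fun heq => ?_
      -- The relation x_i T_l = x_l T_i separates consecutive kernels, giving a strict chain of
      -- primes.
      have h1 : (MvPolynomial.C (x i) * MvPolynomial.X l - MvPolynomial.C (x l) * MvPolynomial.X i :
          MvPolynomial σ R) ∈ RingHom.ker (proportionalSubstitution g x i (insert l U)) := by
        rw [RingHom.mem_ker]
        simp only [proportionalSubstitution, map_sub, map_mul, MvPolynomial.coe_eval₂Hom,
          MvPolynomial.eval₂_C, MvPolynomial.eval₂_X, Finset.mem_insert, true_or, if_true, hU.1,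
          hU.2, or_self, if_false, RingHom.comp_apply]
        rw [← mul_assoc, ← map_mul, mul_div_cancel₀ _ hi, sub_self]
      rw [← heq, RingHom.mem_ker] at h1
      simp only [proportionalSubstitution, map_sub, map_mul, MvPolynomial.coe_eval₂Hom,
        MvPolynomial.eval₂_C, MvPolynomial.eval₂_X, hl, hU.2, if_false, RingHom.comp_apply] at h1
      exact MvPolynomial.C_mul_X_sub_C_mul_X_ne_zero l i (fun h => hU.1 h.symm) _ _ hi h1
    have hp1 := RingHom.ker_isPrime (proportionalSubstitution g x i U)
    have hp2 := RingHom.ker_isPrime (proportionalSubstitution g x i (insert l U))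
    have h3 := Ideal.height_add_one_le_of_lt_of_isPrime hlt
    rw [Finset.card_insert_of_notMem hl]
    push_cast
    exact (add_le_add_left (ih hU.2) 1).trans h3

/-- The presentation of the Rees algebra of `(x)` as a quotient of a polynomial ring. -/
noncomputable def reesPresentation {R σ : Type*} [CommRing R] (x : σ → R) :
    MvPolynomial σ R →ₐ[R] reesAlgebra (Ideal.span (Set.range x)) :=
  MvPolynomial.aeval fun l => reesDegreeOne (Ideal.span (Set.range x)) (x l)
      (Ideal.subset_span (Set.mem_range_self l))

theorem reesPresentation_surjective {R : Type*} [CommRing R] {d : ℕ} (x : Fin d → R) :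
    Function.Surjective (reesPresentation x) := by
  rw [← AlgHom.coe_toLinearMap, ← LinearMap.range_eq_top, eq_top_iff, ← span_range_reesMonomial,
    Submodule.span_le]
  rintro _ ⟨⟨⟨a, n⟩, h⟩, rfl⟩
  change n ≤ ∑ i, a i at h
  induction n generalizing a with
  | zero =>
    refine ⟨MvPolynomial.C (∏ i, x i ^ a i), ?_⟩
    rw [AlgHom.coe_toLinearMap, ← MvPolynomial.algebraMap_eq, AlgHom.commutes]
    rfl
  | succ n ih =>
    obtain ⟨k, -, hk⟩ : ∃ k ∈ Finset.univ, a k ≠ 0 := by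
      by_contra! h'
      rw [Finset.sum_eq_zero h'] at h
      omega
    obtain ⟨b, rfl⟩ : ∃ b : Fin d → ℕ, a = b + Pi.single k 1 := by
      refine ⟨a - Pi.single k 1, ?_⟩
      ext i
      by_cases hi : i = k
      · subst hi
        simp
        omega
      · simp [hi]
    have hb : n ≤ ∑ i, b i := by
      simp only [Pi.add_apply, Finset.sum_add_distrib, Finset.sum_pi_single', Finset.mem_univ,
        if_true] at h
      omega
    obtain ⟨p, hp⟩ := ih b hb
    refine ⟨MvPolynomial.X k * p, ?_⟩
    rw [AlgHom.coe_toLinearMap] at hp ⊢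
    rw [map_mul, hp, reesPresentation, MvPolynomial.aeval_X]
    have := reesGenerators_inr_pow_mul_reesMonomial x k 1 b n hb (by rwa [add_comm])
    rw [pow_one] at this
    exact Eq.trans this (congrArg (reesMonomial x) (Subtype.ext
      (Prod.ext rfl (add_comm 1 n))))

/-- A minimal prime below Q is contracted from R[t] and lies over a prime of R containing a minimal
prime q; x_i is not in q, being a nonzerodivisor. The substitution T_l ↦ (x_l/x_i) T_i over
Frac(R/q), followed by T_l ↦ x_l t, is the map R[T] → Frac(R/q)[t] through the Rees algebra. Hence
its kernel, of height at least d - 1, lies in the preimage of Q. -/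
theorem le_height_comap_reesPresentation {R : Type*} [CommRing R] {d : ℕ} (x : Fin d → R)
    (i : Fin d) (hi : x i ∈ nonZeroDivisors R) (Q : Ideal (reesAlgebra (Ideal.span (Set.range x))))
    [hQ : Q.IsPrime] : ((d - 1 : ℕ) : ℕ∞) ≤ (Q.comap (reesPresentation x)).height := by
  classical
  set ι : reesAlgebra (Ideal.span (Set.range x)) →+* Polynomial R :=
    (reesAlgebra (Ideal.span (Set.range x))).val.toRingHom with hι
  have hinj : Function.Injective ι := Subtype.val_injective
  obtain ⟨Q₀, hQ₀, hQ₀Q⟩ := Ideal.exists_minimalPrimes_le (I := ⊥) (J := Q) bot_le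
  obtain ⟨P, hP, rfl⟩ := Ideal.exists_comap_eq_of_mem_minimalPrimes_of_injective hinj Q₀ hQ₀
  obtain ⟨q, hq, hqP⟩ := Ideal.exists_minimalPrimes_le (I := ⊥) (J := P.comap Polynomial.C) bot_le
  have hqp : q.IsPrime := hq.1.1
  have hxq : x i ∉ q := fun h =>
    Set.disjoint_left.mp (Ideal.disjoint_nonZeroDivisors_of_mem_minimalPrimes hq) h hi
  set g : R →+* FractionRing (R ⧸ q) := (algebraMap (R ⧸ q) _).comp (Ideal.Quotient.mk q) with hg
  have hgq : ∀ r, g r = 0 ↔ r ∈ q := by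
    intro r
    rw [hg, RingHom.comp_apply, map_eq_zero_iff _ (IsFractionRing.injective (R ⧸ q) _),
      Ideal.Quotient.eq_zero_iff_mem]
  have hgi : g (x i) ≠ 0 := fun h => hxq ((hgq _).mp h)
  have h1 := card_le_height_ker_proportionalSubstitution g x i hgi (Finset.univ.erase i)
    (Finset.notMem_erase i _)
  rw [Finset.card_erase_of_mem (Finset.mem_univ i), Finset.card_univ, Fintype.card_fin] at h1
  refine h1.trans (Ideal.height_mono ?_)
  have hcomp : (MvPolynomial.eval₂Hom Polynomial.C
      (fun l => Polynomial.C (g (x l)) * Polynomial.X)).comp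
        (proportionalSubstitution g x i (Finset.univ.erase i)) =
      ((Polynomial.mapRingHom g).comp ι).comp (reesPresentation x).toRingHom := by
    apply MvPolynomial.ringHom_ext
    · intro r
      have : (reesPresentation x) (MvPolynomial.C r) = algebraMap R _ r := by
        rw [← MvPolynomial.algebraMap_eq, AlgHom.commutes]
      simp only [RingHom.comp_apply, AlgHom.toRingHom_eq_coe, RingHom.coe_coe, this]
      simp [proportionalSubstitution, hι]
    · intro l
      have h2 : ι (reesPresentation x (MvPolynomial.X l)) = Polynomial.monomial 1 (x l) := by
        simp [reesPresentation, reesDegreeOne, hι]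
      simp only [RingHom.comp_apply, AlgHom.toRingHom_eq_coe, RingHom.coe_coe, h2]
      by_cases hl : l = i
      · subst hl
        simp [proportionalSubstitution, Polynomial.C_mul_X_eq_monomial]
      · simp only [proportionalSubstitution, MvPolynomial.coe_eval₂Hom, MvPolynomial.eval₂_X,
          Finset.mem_erase, Finset.mem_univ, hl, ne_eq, not_false_eq_true, and_self, if_true,
          MvPolynomial.eval₂_mul, MvPolynomial.eval₂_C, Polynomial.coe_mapRingHom,
          Polynomial.map_monomial]
        rw [← mul_assoc, ← Polynomial.C_mul, div_mul_cancel₀ _ hgi, Polynomial.C_mul_X_eq_monomial]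
  intro a ha
  rw [RingHom.mem_ker] at ha
  apply hQ₀Q
  rw [Ideal.mem_comap]
  have h2 := congrArg (fun f => f a) hcomp
  simp only [RingHom.comp_apply, ha, map_zero] at h2
  have h3 : (Ideal.map Polynomial.C q) ≤ P := Ideal.map_le_iff_le_comap.mpr hqP
  apply h3
  rw [Ideal.mem_map_C_iff]
  intro n
  rw [← hgq]
  have h4 := congrArg (fun p => Polynomial.coeff p n) h2
  simpa using h4.symm

/-- Upper bound: R[T_1, …, T_d] has dimension 2d, and primes of the Rees algebra pull back to height
at least d - 1, leaving coheight at most d + 1. Lower bound: x_i t is a nonzerodivisor killed by the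
surjection onto R taking constant coefficients. -/
theorem ringKrullDim_reesAlgebra {R : Type*} [CommRing R] [IsNoetherianRing R] [Nontrivial R]
    {d : ℕ}
    (hdim : ringKrullDim R = d) (x : Fin d → R) (i : Fin d) (hi : x i ∈ nonZeroDivisors R) :
    ringKrullDim (reesAlgebra (Ideal.span (Set.range x))) = (d + 1 : ℕ) := by
  have hd : 1 ≤ d := i.pos
  apply le_antisymm
  · have hA : ringKrullDim (MvPolynomial (Fin d) R) = ((d + d : ℕ) : ℕ∞) := by
      rw [MvPolynomial.ringKrullDim_of_isNoetherianRing, hdim, Nat.card_fin]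
      push_cast
      rfl
    rw [ringKrullDim, Order.krullDim_eq_iSup_coheight]
    refine iSup_le fun Q => ?_
    set P : PrimeSpectrum (MvPolynomial (Fin d) R) :=
      PrimeSpectrum.comap (reesPresentation x).toRingHom Q with hP
    have hmono : StrictMono (PrimeSpectrum.comap (reesPresentation x).toRingHom) := by
      refine Monotone.strictMono_of_injective ?_ ?_
      · intro Q Q' h
        exact Ideal.comap_mono h
      · exact PrimeSpectrum.comap_injective_of_surjective _ (reesPresentation_surjective x)
    have h1 := Order.coheight_le_coheight_apply_of_strictMono _ hmono Q
    have h2 : ((d - 1 : ℕ) : ℕ∞) ≤ Order.height P := by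
      rw [← PrimeSpectrum.height_eq_orderHeight]
      exact le_height_comap_reesPresentation x i hi Q.asIdeal
    have h3 : ((Order.height P + Order.coheight P : ℕ∞) : WithBot ℕ∞) ≤ ((d + d : ℕ) : ℕ∞) := by
      rw [← hA, ringKrullDim, Order.krullDim_eq_iSup_height_add_coheight_of_nonempty]
      exact_mod_cast le_iSup (fun P : PrimeSpectrum (MvPolynomial (Fin d) R) =>
        Order.height P + Order.coheight P) P
    have h4 : Order.height P + Order.coheight P ≤ ((d + d : ℕ) : ℕ∞) := by exact_mod_cast h3
    have h5 : ((d - 1 : ℕ) : ℕ∞) + Order.coheight Q ≤ ((d + d : ℕ) : ℕ∞) :=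
      (add_le_add h2 h1).trans h4
    have h6 : Order.coheight Q ≠ ⊤ := by
      intro h
      rw [h, add_top, top_le_iff] at h5
      exact ENat.natCast_ne_top _ h5
    obtain ⟨c, hc⟩ := ENat.ne_top_iff_exists.mp h6
    rw [← hc] at h5 ⊢
    have h7 : d - 1 + c ≤ d + d := by exact_mod_cast h5
    have h8 : c ≤ d + 1 := by omega
    exact_mod_cast h8
  · have hsurj : Function.Surjective (Polynomial.constantCoeff.comp
        (reesAlgebra (Ideal.span (Set.range x))).val.toRingHom) := fun r =>
      ⟨algebraMap R _ r, by simp⟩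
    have h1 := ringKrullDim_succ_le_of_surjective _ hsurj
      (r := reesDegreeOne (Ideal.span (Set.range x)) (x i)
        (Ideal.subset_span (Set.mem_range_self i))) (by
        rw [mem_nonZeroDivisors_iff_right]
        intro p hp
        apply Subtype.ext
        have h2 := congrArg Subtype.val hp
        ext n
        have h3 := congrArg (fun p => Polynomial.coeff p (n + 1)) h2
        simp only [reesDegreeOne, MulMemClass.coe_mul, ZeroMemClass.coe_zero,
          Polynomial.coeff_zero, Polynomial.coeff_mul_monomial] at h3
        exact (mem_nonZeroDivisors_iff_right.mp hi) _ h3) (by simp [reesDegreeOne])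
    rw [hdim] at h1
    exact_mod_cast h1

end ReesDimension

/-! ### Assembling the theorem. -/

section Main

theorem IsCohenMacaulayLocal.mem_nonZeroDivisors {R : Type*} [CommRing R] [IsLocalRing R]
    (hCM : IsCohenMacaulayLocal R) {d : ℕ} (hdim : ringKrullDim R = (d + 1 : ℕ))
    (x : Fin (d + 1) → R)
    (hI : (Ideal.span (Set.range x)).radical = IsLocalRing.maximalIdeal R) :
    x 0 ∈ nonZeroDivisors R := by
  have hspan : Ideal.ofList (List.ofFn x) = Ideal.span (Set.range x) := by
    unfold Ideal.ofList
    congr 1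
    ext r
    exact List.mem_ofFn
  have h := hCM.isWeaklyRegular hdim (by omega) (List.ofFn x) (by simp) (by rw [hspan, hI])
  rw [List.ofFn_succ, RingTheory.Sequence.isWeaklyRegular_cons_iff] at h
  rw [mem_nonZeroDivisors_iff_right]
  intro y hy
  exact h.1 (by simpa [mul_comm] using hy)

theorem Module.length_quotient_ne_top_of_radical_eq_maximalIdeal {R : Type*} [CommRing R]
    [IsLocalRing R] [IsNoetherianRing R] (I : Ideal R)
    (hI : I.radical = IsLocalRing.maximalIdeal R) : Module.length R (R ⧸ I) ≠ ⊤ := by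
  have hdim : Ring.KrullDimLE 0 (R ⧸ I) := by
    rw [Ring.krullDimLE_zero_iff]
    intro P hP
    have h1 : (P.comap (Ideal.Quotient.mk I)) = IsLocalRing.maximalIdeal R := by
      apply le_antisymm
      · exact IsLocalRing.le_maximalIdeal (hP.comap _).ne_top
      · rw [← hI, (hP.comap _).radical_le_iff]
        intro r hr
        rw [Ideal.mem_comap, Ideal.Quotient.eq_zero_iff_mem.mpr hr]
        exact P.zero_mem
    have h2 : (P.comap (Ideal.Quotient.mk I)).IsMaximal := by
      rw [h1]
      infer_instance
    have h3 := Ideal.map_eq_top_or_isMaximal_of_surjective (Ideal.Quotient.mk I)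
      Ideal.Quotient.mk_surjective h2
    rw [Ideal.map_comap_of_surjective _ Ideal.Quotient.mk_surjective] at h3
    exact h3.resolve_left hP.ne_top
  have hart : IsArtinianRing (R ⧸ I) := IsNoetherianRing.isArtinianRing_of_krullDimLE_zero
  rw [Module.length_eq_of_surjective (R := R ⧸ I) Ideal.Quotient.mk_surjective]
  exact Module.length_ne_top

theorem theorem3 {R : Type*} [CommRing R] [IsLocalRing R] (hCM : IsCohenMacaulayLocal R)
    (d : ℕ) (hdim : ringKrullDim R = d) (hd : 2 ≤ d)
    (x : Fin d → R) (hI : IsParameterIdeal (Ideal.span (Set.range x))) :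
    -- all the lengths are finite
    (∀ s : ℕ, 1 ≤ s → generalizedHK R (reesGenerators x) s ≠ ⊤) ∧
    -- the case `s < d`, with `d = k₁ s + k₂` and `0 ≤ k₂ ≤ s - 1`
    (∀ s k₁ k₂ : ℕ, 1 ≤ s → s < d → k₂ < s → d = k₁ * s + k₂ →
      (k₂ = 0 →
        ((generalizedHK R (reesGenerators x) s).toNat : ℝ) =
          hilbertSamuelMultiplicity (Ideal.span (Set.range x)) *
            (((d : ℝ) - k₁ + 1) * (s : ℝ) ^ (d + 1)
              + (d : ℝ) * ((s + d - 1).choose (d + 1) : ℝ)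
              - ∑ i ∈ Finset.range d, (-1 : ℝ) ^ i * (d.choose i : ℝ) *
                  ((Ring.choose (((d : ℤ) - i - k₁ + 1) * s + d - 1) (d + 1) : ℤ) : ℝ))) ∧
      (k₂ ≠ 0 →
        ((generalizedHK R (reesGenerators x) s).toNat : ℝ) =
          hilbertSamuelMultiplicity (Ideal.span (Set.range x)) *
            (((d : ℝ) - k₁) * (s : ℝ) ^ (d + 1)
              + (d : ℝ) * ((s + d - 1).choose (d + 1) : ℝ)
              - ∑ i ∈ Finset.range d, (-1 : ℝ) ^ i * (d.choose i : ℝ) *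
                  ((Ring.choose (((d : ℤ) - i - k₁) * s + d - 1) (d + 1) : ℤ) : ℝ)))) ∧
    -- the case `s ≥ d`
    (∀ s : ℕ, d ≤ s →
      ((generalizedHK R (reesGenerators x) s).toNat : ℝ) =
        hilbertSamuelMultiplicity (Ideal.span (Set.range x)) *
          ((d : ℝ) * (s : ℝ) ^ (d + 1) / 2 - (s : ℝ) ^ d * ((d : ℝ) - 2) / 2
            + (d : ℝ) * ((s + d - 1).choose (d + 1) : ℝ))) ∧
    -- for `s ≥ d` the function is a polynomial with the following leading coefficients
    (∃ P : Polynomial ℝ, P.natDegree = d + 1 ∧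
      P.coeff (d + 1) = hkConstant d * hilbertSamuelMultiplicity (Ideal.span (Set.range x)) ∧
      P.coeff d = hilbertSamuelMultiplicity (Ideal.span (Set.range x)) *
        (((d : ℝ) - 2) / 2) * (1 / ((d - 1).factorial : ℝ) - 1) ∧
      P.coeff (d - 1) = hilbertSamuelMultiplicity (Ideal.span (Set.range x)) *
        ((d : ℝ) * ((d : ℝ) - 1) * (3 * (d : ℝ) - 10) / (24 * ((d - 1).factorial : ℝ))) ∧
      ∀ s : ℕ, d ≤ s →
        ((generalizedHK R (reesGenerators x) s).toNat : ℝ) = P.eval (s : ℝ)) ∧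
    -- the generalized Hilbert-Kunz multiplicity
    HasGeneralizedHKMultiplicity R (reesGenerators x)
      (hkConstant d * hilbertSamuelMultiplicity (Ideal.span (Set.range x))) := by
  have hN := hCM.1
  have hrad := hI.1
  set I := Ideal.span (Set.range x) with hIdef
  have hx := hCM.mem_span_pow_of_mul_mem hdim x hrad
  obtain ⟨L, hL⟩ := ENat.ne_top_iff_exists.mp
    (Module.length_quotient_ne_top_of_radical_eq_maximalIdeal I hrad)
  have hL0 : (L : ℝ) ≠ 0 := by
    have hne : I ≠ ⊤ := by
      intro h
      rw [h, Ideal.radical_top] at hrad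
      exact (IsLocalRing.maximalIdeal.isMaximal R).ne_top hrad.symm
    have : Nontrivial (R ⧸ I) := Ideal.Quotient.nontrivial_iff.mpr hne
    have h1 : 0 < Module.length R (R ⧸ I) := Module.length_pos
    rw [← hL] at h1
    have h2 : 0 < L := by exact_mod_cast h1
    exact_mod_cast h2.ne'
  have he : hilbertSamuelMultiplicity I = L := by
    refine hilbertSamuelMultiplicity_eq_of_length hdim I L fun n => ?_
    rw [Module.length_quotient_span_range_pow x hx n (sumLT d n) (fun a => mem_sumLT),
      card_sumLT d n (by omega), ← hL]
  have hHK : ∀ s : ℕ, ∃ c : ℕ, generalizedHK R (reesGenerators x) s = ((c * L : ℕ) : ℕ∞) ∧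
      2 * c = d * (s - 1) * s ^ d + 2 * s ^ d + 2 * (d * (s + d - 1).choose (d + 1)) := by
    intro s
    obtain ⟨F, hF, hcard⟩ := exists_finset_compl_reesBracketExponents d s
    refine ⟨F.card, ?_, hcard⟩
    rw [generalizedHK_reesGenerators x hx s F hF, ← hL]
    push_cast
    rfl
  -- The formula is valid for all s ≥ 1, so the case s < d needs only the binomial identity.
  have hformula : ∀ s : ℕ, 1 ≤ s → ((generalizedHK R (reesGenerators x) s).toNat : ℝ) =
      L * ((d : ℝ) * (s : ℝ) ^ (d + 1) / 2 - (s : ℝ) ^ d * ((d : ℝ) - 2) / 2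
            + (d : ℝ) * ((s + d - 1).choose (d + 1) : ℝ)) := by
    intro s hs
    obtain ⟨c, hc, hc2⟩ := hHK s
    have h2 := congrArg (Nat.cast : ℕ → ℝ) hc2
    push_cast [Nat.cast_sub hs] at h2
    rw [hc, ENat.toNat_natCast, Nat.cast_mul]
    linear_combination (L : ℝ) / 2 * h2
  have hidentity : ∀ (s : ℕ) (D : ℤ), (∃ m : ℕ, m ≤ d ∧ (D - d) * s + d - 1 = m) →
      (d : ℝ) * (s : ℝ) ^ (d + 1) / 2 - (s : ℝ) ^ d * ((d : ℝ) - 2) / 2 =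
        D * (s : ℝ) ^ (d + 1) - ∑ i ∈ Finset.range d, (-1 : ℝ) ^ i * (d.choose i : ℝ) *
          ((Ring.choose ((D - i) * s + d - 1) (d + 1) : ℤ) : ℝ) := by
    intro s D hD
    rw [sum_range_neg_one_pow_mul_choose_mul_ringChoose d s D hD]
    ring
  obtain ⟨P, hPdeg, hP1, hP2, hP3, hP4⟩ := exists_polynomial_hilbertKunz d hd L hL0
  rw [he]
  refine ⟨?_, ?_, fun s hs => hformula s (by omega), ⟨P, hPdeg, hP1, hP2, hP3, fun s hs => ?_⟩, ?_⟩
  · intro s _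
    obtain ⟨c, hc, -⟩ := hHK s
    rw [hc]
    exact ENat.natCast_ne_top _
  · intro s k₁ k₂ hs hsd hk₂ hdk
    have hdk' : (d : ℤ) = k₁ * s + k₂ := by exact_mod_cast hdk
    refine ⟨fun hk => ?_, fun hk => ?_⟩
    -- Since d = k₁ s, the term i = d has upper entry (1 - k₁)s + d - 1 = s - 1.
    · have h := hidentity s (d - k₁ + 1) ⟨s - 1, by omega, by
        rw [hk, Nat.cast_zero, add_zero] at hdk'
        rw [Nat.cast_sub hs]
        push_cast
        linear_combination hdk'⟩
      rw [hformula s hs, h]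
      have h2 : ∀ i : ℕ, ((d : ℤ) - i - k₁ + 1) = d - k₁ + 1 - i := fun i => by ring
      simp only [h2]
      push_cast
      ring
    -- Here the upper entry is d - k₁ s - 1 = k₂ - 1, nonnegative because k₂ ≠ 0.
    · have h := hidentity s (d - k₁) ⟨k₂ - 1, by omega, by
        rw [Nat.cast_sub (by omega)]
        push_cast
        linear_combination hdk'⟩
      rw [hformula s hs, h]
      have h2 : ∀ i : ℕ, ((d : ℤ) - i - k₁) = d - k₁ - i := fun i => by ring
      simp only [h2]
      push_cast
      ring
  · rw [hformula s (by omega), hP4 s (by omega)]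
  · obtain ⟨n, rfl⟩ := Nat.exists_eq_add_of_le' hd
    have hk : krullDimNat (reesAlgebra I) = n + 2 + 1 := by
      simp only [krullDimNat]
      rw [ringKrullDim_reesAlgebra hdim x 0 (hCM.mem_nonZeroDivisors hdim x hrad)]
      rfl
    unfold HasGeneralizedHKMultiplicity
    rw [hk, ← hP1]
    exact tendsto_eval_div_pow P _ hPdeg _ 1
      (fun s hs => by rw [hformula s hs, hP4 s hs]) (by omega)

end Main
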